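/- Let $n\ge 4$. The Young wall pattern of type $D_n$ consists of columns $i=0,1,2,\dots$ (from left to right) with positions at levels $y=0,1,2,\dots$. A position whose level is divisible by $n-2$ is divided into two triangular half-blocks, an upper and a lower one; every other position carries one full block. Going up a column, the labels are $0/1,\,2,\,3,\dots,n-2,\,(n-1)/n,\,n-2,\dots,3,\,2$, repeated with period $2n-4$; the divided positions carry the two labels $0,1$, respectively $n-1,n$, where the smaller label is on the upper half-block if $i$ is even and on the lower one if $i$ is odd. The lower half-blocks of level $0$ are grey, all other blocks are white. A *Young wall* of type $D_n$ is a subset $Y$ of the pattern such that: (1) $Y$ contains all grey half-blocks and finitely many white blocks; (2) no block of $Y$ lies on top of a missing block or half-block; (3) if a block of column $i+1$ is in $Y$, then so is the block of column $i$ at the same level (for half-blocks: the half-block of the same orientation); (4) no two full columns have the same height, where a column is full if at its top there is a full block or both half-blocks. Let $\mathcal Z_\Delta$ be the set of Young walls of type $D_n$, let $\mathrm{wt}_j(Y)$ be the number of white blocks and half-blocks of label $j$ in $Y$, and let $$Z_\Delta(q_0,\dots,q_n)=\sum_{Y\in\mathcal Z_\Delta}\prod_{j=0}^n q_j^{\mathrm{wt}_j(Y)}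 .$$ A missing block $b\notin Y$ is *salient* if $Y\cup\{b\}$ is again a Young wall. A missing half-block at column $i$, level $y$ is *directly supported* if the other half-block at this position is missing too, every block at column $i$, level $y-1$ is in $Y$ (no condition if $y=0$), $i\ge1$, and some block at column $i-1$, level $y+1$ is missing. A Young wall $Y$ is *$0$-generated* if * for every salient half-block of label $n-1$ or $n$, both half-blocks at its position are salient and directly supported; * no salient block of $Y$ has label in $\{1,\dots,n-2\}$. It is *distinguished* if moreover * every maximal series of consecutive columns of equal height which end in a single half-block of label $n-1$ or $n$ is longer than $n-1$. Let $\mathcal Z_\Delta^0$ be the set of distinguished $0$-generated Young walls. **Theorem.** For every $k\ge0$ there are only finitely many $Y\in\mathcal Z_\Delta$ with $\mathrm{wt}_0(Y)=k$. If $\xi\in\mathbb C$ is a primitive $(2n-1)$-st root of unity, then $$\sum_{Y\in\mathcal Z_\Delta^0}q^{\mathrm{wt}_0(Y)}=Z_\Delta(q_0,\dots,q_n)\Big|_{q_0=\xi^2q,\ q_1=\dots=q_n=\xi}$$ as formal power series in $q$. -/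

import Mathlib

namespace DWall

open scoped PowerSeries.WithPiTopology

/-- Shapes of the blocks of the pattern: full (square) blocks, and the upper and the lower
triangular half-blocks into which a divided square is cut. -/
inductive Shape where
  | square
  | upper
  | lower

/-- A block or half-block, in column `col` (columns are counted from the left, starting at `0`)
and at vertical position `lev` in its column (counted from the bottom, starting at `0`). -/
structure Block where
  col : ℕ
  lev : ℕ
  shape : Shape

/-- The other half of a divided square. -/
def Shape.flip : Shape → Shape
  | .square => .square
  | .upper => .lower
  | .lower => .upper

/-- The complementary half-block, at the same position. -/
def Block.flip (b : Block) : Block := ⟨b.col, b.lev, b.shape.flip⟩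

/-- The Young wall pattern of type `D_n`: the squares at the levels divisible by `n - 2` are divided
into two half-blocks, all other squares are full blocks. -/
def pattern (n : ℕ) : Set Block := {b | b.shape = Shape.square ↔ ¬ (n - 2) ∣ b.lev}

/-- The grey half-blocks, which are the lower halves in the bottom level. All other blocks and
half-blocks of the pattern are white. -/
def Block.IsGrey (b : Block) : Prop := b.lev = 0 ∧ b.shape = Shape.lower

/-- `0` for upper half-blocks in even columns and lower half-blocks in odd columns, `1` for the
other half-blocks: the two labels at the divided positions alternate from column to column. -/
def Block.halfIndex (b : Block) : ℕ :=
  match b.shape with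
  | .upper => b.col % 2
  | _ => (b.col + 1) % 2

/-- The label of a block. Going up a column, the labels are
`0/1, 2, 3, …, n - 2, (n-1)/n, n - 2, …, 3, 2`, repeated with period `2 n - 4`. -/
def label (n : ℕ) (b : Block) : ℕ :=
  if b.lev % (2 * n - 4) = 0 then b.halfIndex
  else if b.lev % (2 * n - 4) = n - 2 then n - 1 + b.halfIndex
  else if b.lev % (2 * n - 4) < n - 2 then b.lev % (2 * n - 4) + 1
  else 2 * n - 3 - b.lev % (2 * n - 4)

/-- The `i`-th column of `Y` is full, with its topmost square at level `y`: either a full block or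
both half-blocks are present there, and there is nothing above. -/
def IsFullColumn (n : ℕ) (Y : Set Block) (i y : ℕ) : Prop :=
  (∀ b ∈ pattern n, b.col = i → b.lev = y → b ∈ Y) ∧ ∀ b ∈ Y, b.col = i → b.lev ≤ y

/-- The rules for (proper) Young walls of type `D_n`. -/
structure IsYoungWall (n : ℕ) (Y : Set Block) : Prop where
  subset_pattern : Y ⊆ pattern n
  /-- all grey half-blocks are in `Y` -/
  grey_mem : ∀ b ∈ pattern n, b.IsGrey → b ∈ Y
  /-- only finitely many white blocks are in `Y` -/
  finite_white : {b ∈ Y | ¬ b.IsGrey}.Finite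
  /-- no block is placed on top of a missing block or half-block -/
  column : ∀ b ∈ Y, ∀ c ∈ pattern n, c.col = b.col → c.lev + 1 = b.lev → c ∈ Y
  /-- there is no free position to the left of a block; for half-blocks, only the half-block of the
  same orientation has to be present -/
  left : ∀ (i y : ℕ) (s : Shape), (⟨i + 1, y, s⟩ : Block) ∈ Y → (⟨i, y, s⟩ : Block) ∈ Y
  /-- no two full columns have the same height -/
  proper : ∀ i j y, IsFullColumn n Y i y → IsFullColumn n Y j y → i = j

/-- The set of all Young walls of type `D_n`. -/
def YoungWall (n : ℕ) : Type := {Y : Set Block // IsYoungWall n Y}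

/-- The `j`-weight of a set of blocks: its number of white blocks and half-blocks of label `j`. -/
noncomputable def wt (n : ℕ) (Y : Set Block) (j : ℕ) : ℕ :=
  {b ∈ Y | ¬ b.IsGrey ∧ label n b = j}.ncard

/-- The multi-weight `(wt_0(Y), …, wt_n(Y))`. -/
noncomputable def wtVec (n : ℕ) (Y : Set Block) : Fin (n + 1) →₀ ℕ :=
  Finsupp.equivFunOnFinite.symm fun j => wt n Y j

/-- A salient block of `Y`: a missing block which can be added to `Y` without violating the rules of
Young walls. (Whether this is possible depends only on the columns to the left of the block and on
the blocks below it in its own column.) -/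
def IsSalient (n : ℕ) (Y : Set Block) (b : Block) : Prop :=
  b ∈ pattern n ∧ b ∉ Y ∧ IsYoungWall n (insert b Y)

/-- A missing half-block is directly supported if the complementary half-block is missing too, the
square under their common position is in `Y`, and the full block `c` which is the next one to the
left of and above this position is missing. In the sheared form of the pattern, in which the columns
become the rows and the `i`-th one is shifted by `i`, the block `c` is the one immediately below
the divided position, and the square under it becomes its left neighbour. -/
def IsDirectlySupported (n : ℕ) (Y : Set Block) (b : Block) : Prop :=
  b ∉ Y ∧ b.flip ∉ Y ∧
    (∀ c ∈ pattern n, c.col = b.col → c.lev + 1 = b.lev → c ∈ Y) ∧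
    ∃ c ∈ pattern n, c ∉ Y ∧ c.col + 1 = b.col ∧ c.lev = b.lev + 1

/-- `0`-generated Young walls: each salient block of label `n - 1` or `n` is part of a directly
supported pair of salient half-blocks, and there is no salient block of label `1, …, n - 2`. -/
def IsZeroGenerated (n : ℕ) (Y : Set Block) : Prop :=
  (∀ b, IsSalient n Y b → label n b = n - 1 ∨ label n b = n →
    IsSalient n Y b.flip ∧ IsDirectlySupported n Y b ∧ IsDirectlySupported n Y b.flip) ∧
  ∀ b, IsSalient n Y b → label n b ∉ Set.Icc 1 (n - 2)

/-- The `i`-th column of `Y` ends in a single half-block at level `y`. -/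
def EndsInHalf (Y : Set Block) (i y : ℕ) : Prop :=
  ∃ b ∈ Y, b.col = i ∧ b.lev = y ∧ b.shape ≠ Shape.square ∧ b.flip ∉ Y

/-- Distinguished `0`-generated Young walls: every series of columns of equal height which end in a
single half-block of label `n - 1` or `n` is longer than `n - 1`. (Columns of equal height are
automatically consecutive, and the labels `n - 1`, `n` occur at the levels `n - 2` modulo
`2 n - 4`.) -/
def IsDistinguished (n : ℕ) (Y : Set Block) : Prop :=
  IsZeroGenerated n Y ∧
  ∀ y, y % (2 * n - 4) = n - 2 → (∃ i, EndsInHalf Y i y) → n - 1 < {i | EndsInHalf Y i y}.ncard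

/-- The multi-weight generating series of all Young walls of type `D_n`. -/
noncomputable def wallSeries (n : ℕ) : MvPowerSeries (Fin (n + 1)) ℂ :=
  fun v => (Nat.card {Y : YoungWall n // wtVec n Y.1 = v} : ℂ)

/-- The generating series of the distinguished `0`-generated Young walls by their `0`-weight. -/
noncomputable def distinguishedSeries (n : ℕ) : PowerSeries ℂ :=
  PowerSeries.mk fun k =>
    (Nat.card {Y : YoungWall n // IsDistinguished n Y.1 ∧ wt n Y.1 0 = k} : ℂ)

/-- `G` is the result of the substitution `q_i = s_i` in the formal power series `F`, summed
coefficientwise. -/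
def HasSpecialization {σ : Type} (F : MvPowerSeries σ ℂ) (s : σ → PowerSeries ℂ)
    (G : PowerSeries ℂ) : Prop :=
  HasSum (fun v : σ →₀ ℕ => PowerSeries.C (MvPowerSeries.coeff v F) * v.prod fun i e => s i ^ e) G

end DWall

namespace DWall

/-! A wall is determined by the ends of its columns: a finite set `e` of levels at which a full
column ends (at most one each, by properness), and for each positive divided level `y` a signed
number `d y` of columns ending there in a single half-block. The sign of `d y` records the label of
the leftmost of these half-blocks rather than its orientation, so that conditions on labels do not
depend on the columns further left (`wallOf`, `wallOf_injective`, `IsYoungWall.exists_eq_wallOf`).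

Put `L = 2 n - 4` and cut the wall into layers, one for each period of levels. At a level carrying
the labels `0, 1` write `|d y| = 2 j + β + γ` with bits `β`, `γ`; `β` and `j` go to the layer below
and `γ` to the layer above. Layer `a` becomes a triple `(F, D, j)`: `F` is a subset of `{0, …, 2 n -
3}` made of the bit `γ`, the full columns and the bit `β`, and `D` is the value of `d` at the level
with labels `n - 1, n`. The bit `0` of layer `0` is the parity of the number of columns, which the
rest of the wall determines. With this choice of bits everything becomes local: * twice the
`0`-weight is the sum of `(2 a + 1) (|F| + |D|) + 4 (a + 1) j`; * the number of white blocks plus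
the `0`-weight, which is the exponent of `ξ` after the substitution, is modulo `2 n - 1` a sum over
the elements of all `F`, and the summands run once through the nonzero residues (`rootExp`); `D` and
`j` do not contribute; * being distinguished and `0`-generated is a condition on each layer
separately (`IsAllowed`).

Walls of `0`-weight `k` thus correspond to sequences of layers of total weight `2 k`, and it
suffices to compare layers with fixed `N = |F| + |D|` and `j`. Summing `ξ` over `F` gives `∏ (1 +
ξ^r x) = (1 + x^(2 n - 1)) / (1 + x)`, summing over `D` gives `(1 + x) / (1 - x)`. The product `(1 +
x^(2 n - 1)) / (1 - x)` has coefficients `1` up to `x^(2 n - 2)` and `2` afterwards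
(`sum_layersOfType`). This is also the number of allowed layers: `D = 0` forces `F` to be the final
segment of length `N`, and `D ≠ 0` forces `F` to be the upper half, with `|D| ≥ n` and two choices
of sign (`card_allowed`). -/

/-- The length of an initial segment of `ℕ` that is cut out by a set. -/
theorem mem_iff_lt_ncard {S : Set ℕ} (hf : S.Finite) (hd : ∀ i, i + 1 ∈ S → i ∈ S) (i : ℕ) :
    i ∈ S ↔ i < S.ncard := by
  have hle : ∀ k j, j + k ∈ S → j ∈ S := by
    intro k
    induction k with
    | zero => intro j h; exact h
    | succ k ih => intro j h; exact ih j (hd _ h)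
  have hlow : ∀ i ∈ S, i < S.ncard := by
    intro i hi
    have hsub : (↑(Finset.range (i + 1)) : Set ℕ) ⊆ S := by
      intro j hj
      have hj' : j < i + 1 := by simpa using hj
      apply hle (i - j) j
      rwa [show j + (i - j) = i by omega]
    have := Set.ncard_le_ncard hsub hf
    rw [Set.ncard_coe_finset, Finset.card_range] at this
    omega
  refine ⟨hlow i, fun h => ?_⟩
  by_contra hi
  have hsub : S ⊆ (↑(Finset.range i) : Set ℕ) := by
    intro j hj
    simp only [Finset.coe_range, Set.mem_Iio]
    by_contra hij
    exact hi (hle (j - i) i (by rwa [show i + (j - i) = j by omega]))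
  have := Set.ncard_le_ncard hsub (Finset.finite_toSet _)
  rw [Set.ncard_coe_finset, Finset.card_range] at this
  omega

/-! ### Walls with prescribed column ends -/

/-- The number of columns that end at level `y` or above, in the wall with full columns ending at
the levels in `e` and `|d z|` columns ending in a single half-block at level `z`. -/
def top (e : Finset ℕ) (d : ℕ →₀ ℤ) (y : ℕ) : ℕ :=
  (e.filter (y ≤ ·)).card + ∑ z ∈ d.support.filter (y ≤ ·), (d z).natAbs

/-- The number of columns that contain everything at level `y`. -/
def low (e : Finset ℕ) (d : ℕ →₀ ℤ) (y : ℕ) : ℕ :=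
  (if y ∈ e then 1 else 0) + top e d (y + 1)

theorem top_eq (e : Finset ℕ) (d : ℕ →₀ ℤ) (y : ℕ) :
    top e d y = (d y).natAbs + low e d y := by
  have h1 : (e.filter (y ≤ ·)).card = (if y ∈ e then 1 else 0) + (e.filter (y + 1 ≤ ·)).card := by
    split_ifs with h
    · have : e.filter (y ≤ ·) = insert y (e.filter (y + 1 ≤ ·)) := by
        ext z
        simp only [Finset.mem_filter, Finset.mem_insert]
        constructor
        · rintro ⟨a, b⟩
          by_cases hz : z = y
          · exact Or.inl hz
          · exact Or.inr ⟨a, by omega⟩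
        · rintro (rfl | ⟨a, b⟩)
          · exact ⟨h, le_rfl⟩
          · exact ⟨a, by omega⟩
      rw [this, Finset.card_insert_of_notMem (by simp)]
      omega
    · rw [zero_add]
      congr 1
      ext z
      simp only [Finset.mem_filter]
      refine and_congr_right fun hz => ⟨fun a => ?_, fun a => by omega⟩
      have : z ≠ y := fun q => h (q ▸ hz)
      omega
  have h2 : ∑ z ∈ d.support.filter (y ≤ ·), (d z).natAbs
      = (d y).natAbs + ∑ z ∈ d.support.filter (y + 1 ≤ ·), (d z).natAbs := by
    by_cases h : y ∈ d.support
    · have : d.support.filter (y ≤ ·) = insert y (d.support.filter (y + 1 ≤ ·)) := by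
        ext z
        simp only [Finset.mem_filter, Finset.mem_insert]
        constructor
        · rintro ⟨a, b⟩
          by_cases hz : z = y
          · exact Or.inl hz
          · exact Or.inr ⟨a, by omega⟩
        · rintro (rfl | ⟨a, b⟩)
          · exact ⟨h, le_rfl⟩
          · exact ⟨a, by omega⟩
      rw [this, Finset.sum_insert (by simp)]
    · have h0 : d y = 0 := by simpa using h
      rw [h0, Int.natAbs_zero, zero_add]
      congr 1
      ext z
      simp only [Finset.mem_filter]
      refine and_congr_right fun hz => ⟨fun a => ?_, fun a => by omega⟩
      have : z ≠ y := fun q => h (q ▸ hz)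
      omega
  unfold low
  rw [top, h1, h2, top]
  ring

theorem top_eq_zero {e : Finset ℕ} {d : ℕ →₀ ℤ} {H : ℕ} (hH : ∀ y, H ≤ y → y ∉ e ∧ d y = 0)
    {y : ℕ} (hy : H ≤ y) : top e d y = 0 := by
  unfold top
  rw [Finset.filter_false_of_mem, Finset.filter_false_of_mem]
  · simp
  · intro z hz hyz
    exact (Finsupp.mem_support_iff.1 hz) (hH z (hy.trans hyz)).2
  · intro z hz hyz
    exact (hH z (hy.trans hyz)).1 hz

theorem exists_bound (e : Finset ℕ) (d : ℕ →₀ ℤ) : ∃ H, ∀ y, H ≤ y → y ∉ e ∧ d y = 0 := by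
  refine ⟨(e ∪ d.support).sup id + 1, fun y hy => ?_⟩
  have : y ∉ e ∪ d.support := by
    intro h
    have := Finset.le_sup (f := id) h
    simp only [id] at this
    omega
  simpa [not_or] using this

theorem low_le_top (e : Finset ℕ) (d : ℕ →₀ ℤ) (y : ℕ) : low e d y ≤ top e d y := by
  rw [top_eq]; omega

theorem top_succ_le_low (e : Finset ℕ) (d : ℕ →₀ ℤ) (y : ℕ) : top e d (y + 1) ≤ low e d y := by
  unfold low; omega

theorem top_antitone (e : Finset ℕ) (d : ℕ →₀ ℤ) : Antitone (top e d) :=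
  antitone_nat_of_succ_le fun y => (top_succ_le_low e d y).trans (low_le_top e d y)

/-- The part of a signed number of half-blocks which is of the given shape: positive numbers stand
for upper, negative ones for lower half-blocks. -/
def side : Shape → ℤ → ℕ
  | .square, _ => 0
  | .upper, z => z.toNat
  | .lower, z => (-z).toNat

theorem side_le (s : Shape) (z : ℤ) : side s z ≤ z.natAbs := by
  cases s <;> simp only [side] <;> omega

/-- The signed number of columns ending in a single half-block at level `y`; the sign of `d y` is
twisted by the parity of the number of columns to the left of them. -/
def twist (e : Finset ℕ) (d : ℕ →₀ ℤ) (y : ℕ) : ℤ := (-1) ^ low e d y * d y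

theorem natAbs_twist (e : Finset ℕ) (d : ℕ →₀ ℤ) (y : ℕ) :
    (twist e d y).natAbs = (d y).natAbs := by
  simp [twist, Int.natAbs_mul, Int.natAbs_pow]

theorem twist_of_even {e : Finset ℕ} {d : ℕ →₀ ℤ} {y : ℕ} (h : low e d y % 2 = 0) :
    twist e d y = d y := by
  rw [twist, (Nat.even_iff.2 h).neg_one_pow, one_mul]

theorem twist_of_odd {e : Finset ℕ} {d : ℕ →₀ ℤ} {y : ℕ} (h : low e d y % 2 = 1) :
    twist e d y = -d y := by
  rw [twist, (Nat.odd_iff.2 h).neg_one_pow, neg_one_mul]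

/-- The length of the row of blocks of shape `s` at level `y`. -/
def row (e : Finset ℕ) (d : ℕ →₀ ℤ) (y : ℕ) (s : Shape) : ℕ :=
  low e d y + side s (twist e d y)

theorem low_le_row (e : Finset ℕ) (d : ℕ →₀ ℤ) (y : ℕ) (s : Shape) :
    low e d y ≤ row e d y s := Nat.le_add_right _ _

theorem row_le_top (e : Finset ℕ) (d : ℕ →₀ ℤ) (y : ℕ) (s : Shape) :
    row e d y s ≤ top e d y := by
  rw [top_eq, row, ← natAbs_twist e]
  have := side_le s (twist e d y)
  omega

theorem row_square (e : Finset ℕ) (d : ℕ →₀ ℤ) (y : ℕ) : row e d y .square = low e d y := rfl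

/-- The wall with prescribed ends of columns. -/
def wallOf (n : ℕ) (e : Finset ℕ) (d : ℕ →₀ ℤ) : Set Block :=
  {b | b ∈ pattern n ∧ (b.IsGrey ∨ b.col < row e d b.lev b.shape)}

/-- Single half-blocks on top of columns occur only at positive levels divisible by `n - 2`. -/
def HalfSupported (n : ℕ) (d : ℕ →₀ ℤ) : Prop := ∀ y, d y ≠ 0 → y ≠ 0 ∧ (n - 2) ∣ y

theorem mem_pattern_square {n i y : ℕ} : (⟨i, y, .square⟩ : Block) ∈ pattern n ↔ ¬ (n - 2) ∣ y := by
  simp [pattern]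

theorem mem_pattern_of_ne_square {n i y : ℕ} {s : Shape} (hs : s ≠ .square) :
    (⟨i, y, s⟩ : Block) ∈ pattern n ↔ (n - 2) ∣ y := by
  simp [pattern, hs]

theorem mem_pattern_upper {n i y : ℕ} : (⟨i, y, .upper⟩ : Block) ∈ pattern n ↔ (n - 2) ∣ y :=
  mem_pattern_of_ne_square (by simp)

theorem mem_pattern_lower {n i y : ℕ} : (⟨i, y, .lower⟩ : Block) ∈ pattern n ↔ (n - 2) ∣ y :=
  mem_pattern_of_ne_square (by simp)

theorem mem_wallOf {n : ℕ} {e : Finset ℕ} {d : ℕ →₀ ℤ} {i y : ℕ} {s : Shape} :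
    (⟨i, y, s⟩ : Block) ∈ wallOf n e d ↔
      (⟨i, y, s⟩ : Block) ∈ pattern n ∧ ((y = 0 ∧ s = .lower) ∨ i < row e d y s) := Iff.rfl

theorem finite_of_bounded {S : Set Block} {B H : ℕ} (h : ∀ b ∈ S, b.col < B ∧ b.lev < H) :
    S.Finite := by
  have hT : ({.square, .upper, .lower} : Set Shape).Finite := by simp
  refine (((Set.finite_Iio B).prod ((Set.finite_Iio H).prod hT)).image
    (fun x => (⟨x.1, x.2.1, x.2.2⟩ : Block))).subset ?_
  rintro ⟨i, y, s⟩ hb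
  refine ⟨(i, y, s), ⟨(h _ hb).1, (h _ hb).2, ?_⟩, rfl⟩
  cases s <;> simp

section

variable {n : ℕ} {e : Finset ℕ} {d : ℕ →₀ ℤ}

theorem HalfSupported.zero (hd : HalfSupported n d) : d 0 = 0 := by
  by_contra h; exact (hd 0 h).1 rfl

theorem HalfSupported.eq_zero (hd : HalfSupported n d) {y : ℕ} (h : ¬ (n - 2) ∣ y) : d y = 0 := by
  by_contra h'; exact h (hd y h').2

theorem row_of_eq_zero {y : ℕ} (h : d y = 0) (s : Shape) : row e d y s = low e d y := by
  cases s <;> simp [row, twist, h, side]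

theorem top_of_eq_zero {y : ℕ} (h : d y = 0) : top e d y = low e d y := by
  rw [top_eq, h]; simp

/-- Some block of the pattern lies in column `i` at level `y` exactly if `i < top y`. -/
theorem exists_mem_wallOf (hd : HalfSupported n d) {i y : ℕ} (hi : i < top e d y) :
    ∃ s, (⟨i, y, s⟩ : Block) ∈ wallOf n e d := by
  by_cases hy : (n - 2) ∣ y
  · rw [top_eq, ← natAbs_twist e] at hi
    by_cases hs : 0 ≤ twist e d y
    · refine ⟨.upper, mem_wallOf.2 ⟨mem_pattern_upper.2 hy, Or.inr ?_⟩⟩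
      simp only [row, side]; omega
    · refine ⟨.lower, mem_wallOf.2 ⟨mem_pattern_lower.2 hy, Or.inr ?_⟩⟩
      simp only [row, side]; omega
  · refine ⟨.square, mem_wallOf.2 ⟨mem_pattern_square.2 hy, Or.inr ?_⟩⟩
    rw [row_square, ← top_of_eq_zero (hd.eq_zero hy)]; exact hi

theorem forall_mem_wallOf (hd : HalfSupported n d) {i y : ℕ} :
    (∀ b ∈ pattern n, b.col = i → b.lev = y → b ∈ wallOf n e d) ↔ i < low e d y := by
  constructor
  · intro h
    by_cases hy : (n - 2) ∣ y
    · have hu := (h ⟨i, y, .upper⟩ (mem_pattern_upper.2 hy) rfl rfl).2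
      have hl := (h ⟨i, y, .lower⟩ (mem_pattern_lower.2 hy) rfl rfl).2
      simp only [Block.IsGrey, reduceCtorEq, and_false, false_or, and_true] at hu hl
      by_cases h0 : y = 0
      · rw [row_of_eq_zero (by rw [h0, hd.zero])] at hu; exact hu
      · have hl := hl.resolve_left h0
        simp only [row, side] at hu hl
        omega
    · have := (h ⟨i, y, .square⟩ (mem_pattern_square.2 hy) rfl rfl).2
      simpa [Block.IsGrey, row_square] using this
  · rintro h ⟨j, z, s⟩ hb rfl rfl
    exact mem_wallOf.2 ⟨hb, Or.inr (h.trans_le (low_le_row _ _ _ _))⟩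

/-- The columns complete at level `y` number `low y`, those reaching further up number `top (y +
1)`, and the difference is one or zero according to `y ∈ e`. Properness of `wallOf` follows at once.
-/
theorem isFullColumn_wallOf (hd : HalfSupported n d) {i y : ℕ} :
    IsFullColumn n (wallOf n e d) i y ↔ y ∈ e ∧ i = top e d (y + 1) := by
  unfold IsFullColumn
  rw [forall_mem_wallOf hd]
  constructor
  · rintro ⟨h1, h2⟩
    have h3 : ¬ i < top e d (y + 1) := by
      intro h
      obtain ⟨s, hs⟩ := exists_mem_wallOf hd h
      have := h2 _ hs rfl
      simp at this
    unfold low at h1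
    split_ifs at h1 with h
    · exact ⟨h, by omega⟩
    · omega
  · rintro ⟨h1, rfl⟩
    refine ⟨by simp [low, h1], ?_⟩
    rintro ⟨j, z, s⟩ hb rfl
    by_contra hz
    have hz : y < z := by simpa using hz
    have := (mem_wallOf.1 hb).2.resolve_left (by rintro ⟨rfl, -⟩; omega)
    have h4 := row_le_top e d z s
    have h5 := top_antitone e d (show y + 1 ≤ z from hz)
    omega

theorem isYoungWall_wallOf (hd : HalfSupported n d) : IsYoungWall n (wallOf n e d) where
  subset_pattern := fun _ hb => hb.1
  grey_mem := fun _ hb hg => ⟨hb, Or.inl hg⟩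
  finite_white := by
    obtain ⟨H, hH⟩ := exists_bound e d
    refine finite_of_bounded (B := top e d 0) (H := H) ?_
    rintro ⟨i, y, s⟩ ⟨hb, hg⟩
    have h1 := hb.2.resolve_left hg
    have h2 := h1.trans_le (row_le_top e d y s)
    refine ⟨h2.trans_le (top_antitone e d (Nat.zero_le _)), ?_⟩
    by_contra hy
    rw [top_eq_zero hH (not_lt.1 hy)] at h2
    exact Nat.not_lt_zero _ h2
  column := by
    rintro ⟨i, y, s⟩ hb ⟨j, z, s'⟩ hc rfl rfl
    have : j < row e d (z + 1) s :=
      (mem_wallOf.1 hb).2.resolve_left (by rintro ⟨h, -⟩; exact Nat.succ_ne_zero z h)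
    have h1 := row_le_top e d (z + 1) s
    have h2 := top_succ_le_low e d z
    have h3 := low_le_row e d z s'
    exact mem_wallOf.2 ⟨hc, Or.inr (by omega)⟩
  left := by
    intro i y s h
    rw [mem_wallOf] at h ⊢
    exact ⟨h.1, h.2.imp_right fun h => by omega⟩
  proper := by
    intro i j y hi hj
    rw [isFullColumn_wallOf hd] at hi hj
    rw [hi.2, hj.2]

end

section

variable {n : ℕ} {e e' : Finset ℕ} {d d' : ℕ →₀ ℤ}

theorem row_eq_of_wallOf_eq (h : wallOf n e d = wallOf n e' d') {y : ℕ} {s : Shape}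
    (hp : (⟨0, y, s⟩ : Block) ∈ pattern n) (hg : ¬ (y = 0 ∧ s = .lower)) :
    row e d y s = row e' d' y s := by
  have key : ∀ i, i < row e d y s ↔ i < row e' d' y s := by
    intro i
    have h1 : (⟨i, y, s⟩ : Block) ∈ wallOf n e d ↔ (⟨i, y, s⟩ : Block) ∈ wallOf n e' d' := by rw [h]
    have hp' : (⟨i, y, s⟩ : Block) ∈ pattern n := hp
    simpa [mem_wallOf, hp', hg] using h1
  exact le_antisymm (not_lt.1 fun hl => lt_irrefl _ ((key _).1 hl))
    (not_lt.1 fun hl => lt_irrefl _ ((key _).2 hl))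

/-- At a divided level above `0` the two row lengths are `low` plus the positive, respectively
negative, part of `twist`; their minimum is `low` and their difference is `twist`. -/
theorem low_twist_eq_of_wallOf_eq (hd : HalfSupported n d) (hd' : HalfSupported n d')
    (h : wallOf n e d = wallOf n e' d') (y : ℕ) :
    low e d y = low e' d' y ∧ twist e d y = twist e' d' y := by
  by_cases hy : (n - 2) ∣ y
  · have hu := row_eq_of_wallOf_eq h (mem_pattern_upper.2 hy) (by simp)
    by_cases h0 : y = 0
    · subst h0
      rw [row_of_eq_zero hd.zero, row_of_eq_zero hd'.zero] at hu
      simp [hu, twist, hd.zero, hd'.zero]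
    · have hl := row_eq_of_wallOf_eq h (mem_pattern_lower.2 hy) (by simp [h0])
      simp only [row, side] at hu hl
      omega
  · have hs := row_eq_of_wallOf_eq h (mem_pattern_square.2 hy) (by simp)
    rw [row_square, row_square] at hs
    simp [hs, twist, hd.eq_zero hy, hd'.eq_zero hy]

/-- Knowing `low` means knowing the parity that was used to twist the sign, so `d` is recovered;
then `e` is the set where `low y` exceeds `top (y + 1)`. -/
theorem wallOf_injective (hd : HalfSupported n d) (hd' : HalfSupported n d')
    (h : wallOf n e d = wallOf n e' d') : e = e' ∧ d = d' := by
  have H := low_twist_eq_of_wallOf_eq hd hd' h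
  have hD : ∀ y, d y = d' y := by
    intro y
    obtain ⟨h1, h2⟩ := H y
    rcases Nat.mod_two_eq_zero_or_one (low e d y) with hp | hp
    · rwa [twist_of_even hp, twist_of_even (h1 ▸ hp)] at h2
    · rw [twist_of_odd hp, twist_of_odd (h1 ▸ hp)] at h2
      omega
  refine ⟨?_, Finsupp.ext hD⟩
  ext y
  have h1 := (H y).1
  have h2 : top e d (y + 1) = top e' d' (y + 1) := by
    rw [top_eq, top_eq, hD, (H _).1]
  unfold low at h1
  rw [h2] at h1
  by_cases ha : y ∈ e <;> by_cases hb : y ∈ e' <;> simp [ha, hb] at h1 ⊢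

end

/-! ### Reading off the column ends of an arbitrary wall -/

/-- The lengths of the rows of white blocks of a wall. -/
noncomputable def rowLength (Y : Set Block) (y : ℕ) (s : Shape) : ℕ :=
  {i | (⟨i, y, s⟩ : Block) ∈ Y ∧ ¬ (y = 0 ∧ s = .lower)}.ncard

section

variable {n : ℕ} {Y : Set Block}

theorem IsYoungWall.mem_iff (hY : IsYoungWall n Y) {i y : ℕ} {s : Shape}
    (hg : ¬ (y = 0 ∧ s = .lower)) : (⟨i, y, s⟩ : Block) ∈ Y ↔ i < rowLength Y y s := by
  rw [rowLength, ← mem_iff_lt_ncard]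
  · simp [hg]
  · refine (hY.finite_white.image Block.col).subset ?_
    rintro i ⟨hi, h⟩
    exact ⟨⟨i, y, s⟩, ⟨hi, h⟩, rfl⟩
  · rintro i ⟨hi, h⟩
    exact ⟨hY.left _ _ _ hi, h⟩

theorem IsYoungWall.rowLength_eq_zero (hY : IsYoungWall n Y) {y : ℕ} {s : Shape}
    (h : (⟨0, y, s⟩ : Block) ∉ pattern n) : rowLength Y y s = 0 := by
  unfold rowLength
  rw [show {i | (⟨i, y, s⟩ : Block) ∈ Y ∧ ¬ (y = 0 ∧ s = .lower)} = ∅ from ?_, Set.ncard_empty]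
  refine Set.eq_empty_iff_forall_notMem.2 fun i hi => ?_
  have := hY.subset_pattern hi.1
  exact h this

theorem rowLength_zero_lower : rowLength Y 0 .lower = 0 := by simp [rowLength]

theorem IsYoungWall.exists_bound (hY : IsYoungWall n Y) :
    ∃ H, ∀ y, H ≤ y → ∀ s, rowLength Y y s = 0 := by
  obtain ⟨B, hB⟩ := (hY.finite_white.image Block.lev).bddAbove
  refine ⟨B + 1, fun y hy s => ?_⟩
  by_contra h
  have hg : ¬ (y = 0 ∧ s = .lower) := by omega
  have h1 := (hY.mem_iff (i := 0) hg).2 (Nat.pos_of_ne_zero h)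
  have := hB ⟨⟨0, y, s⟩, ⟨h1, hg⟩, rfl⟩
  simp only at this
  omega

/-- The number of columns with some white block at level `y`. -/
noncomputable def maxRow (Y : Set Block) (y : ℕ) : ℕ :=
  max (rowLength Y y .square) (max (rowLength Y y .upper) (rowLength Y y .lower))

/-- The number of columns with all blocks at level `y`. -/
noncomputable def minRow (Y : Set Block) (y : ℕ) : ℕ :=
  if y = 0 then rowLength Y y .upper
  else max (rowLength Y y .square) (min (rowLength Y y .upper) (rowLength Y y .lower))

theorem IsYoungWall.lt_minRow (hY : IsYoungWall n Y) {i y : ℕ} :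
    i < minRow Y y ↔ ∀ b ∈ pattern n, b.col = i → b.lev = y → b ∈ Y := by
  unfold minRow
  by_cases hy : (n - 2) ∣ y
  · have hs : rowLength Y y .square = 0 := hY.rowLength_eq_zero (by simp [mem_pattern_square, hy])
    have hR : (∀ b ∈ pattern n, b.col = i → b.lev = y → b ∈ Y) ↔
        (⟨i, y, .upper⟩ : Block) ∈ Y ∧ (⟨i, y, .lower⟩ : Block) ∈ Y := by
      constructor
      · intro h
        exact ⟨h _ (mem_pattern_upper.2 hy) rfl rfl, h _ (mem_pattern_lower.2 hy) rfl rfl⟩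
      · rintro ⟨h1, h2⟩ ⟨j, z, s⟩ hb rfl rfl
        cases s
        · exact absurd hy (mem_pattern_square.1 hb)
        · exact h1
        · exact h2
    rw [hR, hY.mem_iff (by simp)]
    split_ifs with h0
    · subst h0
      have : (⟨i, 0, .lower⟩ : Block) ∈ Y :=
        hY.grey_mem _ (mem_pattern_lower.2 hy) ⟨rfl, rfl⟩
      simp [this]
    · rw [hY.mem_iff (by simp [h0]), hs]
      omega
  · have h0 : y ≠ 0 := by rintro rfl; exact hy (dvd_zero _)
    have h1 : rowLength Y y .upper = 0 := hY.rowLength_eq_zero (by simp [mem_pattern_upper, hy])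
    rw [if_neg h0, h1, Nat.zero_min, Nat.max_zero, ← hY.mem_iff (by simp)]
    constructor
    · rintro h ⟨j, z, s⟩ hb rfl rfl
      cases s
      · exact h
      · exact absurd (mem_pattern_upper.1 hb) hy
      · exact absurd (mem_pattern_lower.1 hb) hy
    · intro h
      exact h _ (mem_pattern_square.2 hy) rfl rfl

theorem IsYoungWall.lt_maxRow (hY : IsYoungWall n Y) {i y : ℕ} (hy : y ≠ 0) :
    i < maxRow Y y ↔ ∃ s, (⟨i, y, s⟩ : Block) ∈ Y := by
  unfold maxRow
  rw [lt_max_iff, lt_max_iff, ← hY.mem_iff (by simp), ← hY.mem_iff (by simp),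
    ← hY.mem_iff (by simp [hy])]
  constructor
  · rintro (h | h | h) <;> exact ⟨_, h⟩
  · rintro ⟨s, h⟩
    cases s
    · exact Or.inl h
    · exact Or.inr (Or.inl h)
    · exact Or.inr (Or.inr h)

theorem IsYoungWall.maxRow_succ_le (hY : IsYoungWall n Y) (y : ℕ) :
    maxRow Y (y + 1) ≤ minRow Y y := by
  by_contra h
  obtain ⟨s, hs⟩ := (hY.lt_maxRow (Nat.succ_ne_zero y)).1 (not_le.1 h)
  refine lt_irrefl _ ((hY.lt_minRow (i := minRow Y y)).2 ?_)
  rintro c hc h1 h2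
  exact hY.column _ hs c hc h1 (by rw [h2])

/-- This is where properness enters: every column counted by `minRow Y y` but not by `maxRow Y (y +
1)` is full with top `y`, so there is at most one. -/
theorem IsYoungWall.minRow_le (hY : IsYoungWall n Y) (y : ℕ) :
    minRow Y y ≤ maxRow Y (y + 1) + 1 := by
  by_contra h
  have mem_le : ∀ k z i, i < maxRow Y (z + k + 1) → i < maxRow Y (z + 1) := by
    intro k
    induction k with
    | zero => intro z i h; exact h
    | succ k ih =>
      intro z i h
      refine ih z i (h.trans_le ((hY.maxRow_succ_le _).trans ?_))
      rw [show z + (k + 1) = z + k + 1 by omega]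
      unfold minRow maxRow
      split_ifs <;> omega
  have full : ∀ i, maxRow Y (y + 1) ≤ i → i < minRow Y y → IsFullColumn n Y i y := by
    intro i h1 h2
    refine ⟨hY.lt_minRow.1 h2, ?_⟩
    rintro ⟨j, z, s⟩ hb rfl
    by_contra hz
    have hz : y < z := by simpa using hz
    have := (hY.lt_maxRow (by omega)).2 ⟨s, hb⟩
    have := mem_le (z - (y + 1)) y j (by rwa [show y + (z - (y + 1)) + 1 = z by omega])
    exact absurd h1 (not_le.2 this)
  have := hY.proper _ _ _ (full (maxRow Y (y + 1)) le_rfl (by omega))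
    (full (maxRow Y (y + 1) + 1) (by omega) (by omega))
  omega

/-- Every Young wall is given by the ends of its columns. -/
theorem IsYoungWall.exists_eq_wallOf (hY : IsYoungWall n Y) :
    ∃ e d, HalfSupported n d ∧ Y = wallOf n e d := by
  obtain ⟨H, hH⟩ := hY.exists_bound
  have hmax : ∀ y, H ≤ y → maxRow Y y = 0 := fun y hy => by simp [maxRow, hH y hy]
  have hmin : ∀ y, H ≤ y → minRow Y y = 0 := fun y hy => by simp [minRow, hH y hy]
  -- At level `0` the lower halves are grey and always present, so no column ends there in a single
  -- white half-block.
  let D : ℕ → ℤ := fun y =>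
    if y = 0 then 0 else (rowLength Y y .upper : ℤ) - rowLength Y y .lower
  let e : Finset ℕ := (Finset.range H).filter fun y => minRow Y y ≠ maxRow Y (y + 1)
  let d : ℕ →₀ ℤ := Finsupp.onFinset (Finset.range H) (fun y => (-1) ^ minRow Y y * D y) (by
    intro y hy
    by_contra hyH
    apply hy
    simp only [Finset.mem_range, not_lt] at hyH
    simp [D, hH y hyH])
  have hdvd : ∀ y, ¬ (n - 2) ∣ y → rowLength Y y .upper = 0 ∧ rowLength Y y .lower = 0 := by
    intro y hy
    exact ⟨hY.rowLength_eq_zero (by simp [mem_pattern_upper, hy]),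
      hY.rowLength_eq_zero (by simp [mem_pattern_lower, hy])⟩
  have hsq : ∀ y, (n - 2) ∣ y → rowLength Y y .square = 0 := fun y hy =>
    hY.rowLength_eq_zero (by simp [mem_pattern_square, hy])
  have hd : HalfSupported n d := by
    intro y hy
    have hDy : D y ≠ 0 := by
      intro h; apply hy; simp [d, h]
    constructor
    · rintro rfl; exact hDy rfl
    · by_contra h; apply hDy; simp [D, hdvd y h]
  have hmm : ∀ y, maxRow Y y = (d y).natAbs + minRow Y y := by
    intro y
    have h1 : (d y).natAbs = (D y).natAbs := by
      simp [d, Int.natAbs_mul, Int.natAbs_pow]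
    rw [h1]
    simp only [D, maxRow, minRow]
    by_cases hy : (n - 2) ∣ y
    · split_ifs with h0
      · subst h0
        simp [hsq 0 hy, rowLength_zero_lower]
      · rw [hsq y hy]; omega
    · have h0 : y ≠ 0 := by rintro rfl; exact hy (dvd_zero _)
      rw [if_neg h0, if_neg h0, (hdvd y hy).1, (hdvd y hy).2]
      simp
  have hlow : ∀ y, minRow Y y = (if y ∈ e then 1 else 0) + maxRow Y (y + 1) := by
    intro y
    have h1 := hY.maxRow_succ_le y
    have h2 := hY.minRow_le y
    by_cases hy : y < H
    · by_cases h3 : minRow Y y = maxRow Y (y + 1)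
      · simp [e, h3]
      · have : y ∈ e := by simp [e, h3, hy]
        rw [if_pos this]; omega
    · have : y ∉ e := by simp [e, hy]
      rw [if_neg this, hmin y (not_lt.1 hy), hmax (y + 1) (by omega)]
  have hbound : ∀ y, H ≤ y → y ∉ e ∧ d y = 0 := by
    intro y hy
    refine ⟨by simp [e, hy], ?_⟩
    simp [d, D, hH y hy]
  -- Descending induction from the height `H`, above which both sides vanish.
  have htop : ∀ k y, H ≤ y + k → top e d y = maxRow Y y := by
    intro k
    induction k with
    | zero => intro y hy; rw [top_eq_zero hbound (by omega), hmax y (by omega)]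
    | succ k ih =>
      intro y hy
      rw [top_eq, hmm, low, ih (y + 1) (by omega), hlow y]
  have hlow' : ∀ y, low e d y = minRow Y y := by
    intro y
    rw [low, htop H (y + 1) (by omega), hlow y]
  have htw : ∀ y, twist e d y = D y := by
    intro y
    rw [twist, hlow']
    simp only [d, Finsupp.onFinset_apply]
    rw [← mul_assoc, ← mul_pow]
    simp
  refine ⟨e, d, hd, ?_⟩
  ext ⟨i, y, s⟩
  rw [mem_wallOf]
  by_cases hp : (⟨i, y, s⟩ : Block) ∈ pattern n
  swap
  · simp only [hp, false_and, iff_false]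
    exact fun h => hp (hY.subset_pattern h)
  by_cases hg : y = 0 ∧ s = .lower
  · obtain ⟨rfl, rfl⟩ := hg
    exact iff_of_true (hY.grey_mem _ hp ⟨rfl, rfl⟩) ⟨hp, Or.inl ⟨rfl, rfl⟩⟩
  · rw [hY.mem_iff hg]
    simp only [hp, hg, true_and, false_or]
    suffices rowLength Y y s = row e d y s by rw [this]
    rw [row, htw, hlow']
    by_cases hy : (n - 2) ∣ y
    · by_cases h0 : y = 0
      · subst h0
        cases s
        · exact absurd hy (mem_pattern_square.1 hp)
        · simp [minRow, D, side]
        · simp at hg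
      · cases s
        · exact absurd hy (mem_pattern_square.1 hp)
        · simp only [minRow, D, side, h0, if_false, hsq y hy]; omega
        · simp only [minRow, D, side, h0, if_false, hsq y hy]; omega
    · have h0 : y ≠ 0 := by rintro rfl; exact hy (dvd_zero _)
      cases s
      · simp [minRow, side, h0, hdvd y hy]
      · exact absurd (mem_pattern_upper.1 hp) hy
      · exact absurd (mem_pattern_lower.1 hp) hy

end

/-! ### Salient blocks in terms of column ends -/

section

variable {n : ℕ} {e : Finset ℕ} {d : ℕ →₀ ℤ}

theorem exists_mem_pattern (n i y : ℕ) : ∃ s, (⟨i, y, s⟩ : Block) ∈ pattern n := by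
  by_cases hy : (n - 2) ∣ y
  · exact ⟨_, mem_pattern_upper.2 hy⟩
  · exact ⟨_, mem_pattern_square.2 hy⟩

/-- A missing block is salient if it is the next one in its row, if it does not stick out of the row
below, and if it does not complete a second full column of the same height. -/
theorem isSalient_wallOf_iff (hd : HalfSupported n d) {i y : ℕ} {s : Shape} :
    IsSalient n (wallOf n e d) ⟨i, y, s⟩ ↔
      (⟨i, y, s⟩ : Block) ∈ pattern n ∧ ¬ (y = 0 ∧ s = .lower) ∧ i = row e d y s ∧
      (y = 0 ∨ i < low e d (y - 1)) ∧
      ((∀ s', (⟨i, y, s'⟩ : Block) ∈ pattern n → s' = s ∨ (⟨i, y, s'⟩ : Block) ∈ wallOf n e d) →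
        y ∉ e) := by
  have hW := isYoungWall_wallOf (n := n) (e := e) hd
  constructor
  · rintro ⟨hp, hnot, hY⟩
    have hg : ¬ (y = 0 ∧ s = .lower) := fun h => hnot ⟨hp, Or.inl h⟩
    have hle : row e d y s ≤ i := by
      by_contra h
      exact hnot ⟨hp, Or.inr (not_le.1 h)⟩
    have hi : i = row e d y s := by
      rcases Nat.eq_zero_or_pos i with h0 | h0
      · omega
      · obtain ⟨k, rfl⟩ : ∃ k, i = k + 1 := ⟨i - 1, by omega⟩
        have h1 := hY.left k y s (Set.mem_insert _ _)
        rcases h1 with h1 | h1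
        · simp at h1
        · have := (mem_wallOf.1 h1).2.resolve_left hg
          omega
    have hbelow : y = 0 ∨ i < low e d (y - 1) := by
      rcases Nat.eq_zero_or_pos y with h0 | h0
      · exact Or.inl h0
      · refine Or.inr ((forall_mem_wallOf hd).1 ?_)
        intro c hc h1 h2
        rcases hY.column _ (Set.mem_insert _ _) c hc h1 (by simp only [h2]; omega) with h3 | h3
        · rw [h3] at h2
          simp only at h2
          omega
        · exact h3
    refine ⟨hp, hg, hi, hbelow, fun hall he => ?_⟩
    have hfull : IsFullColumn n (insert ⟨i, y, s⟩ (wallOf n e d)) i y := by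
      constructor
      · rintro ⟨j, z, s'⟩ hb rfl rfl
        rcases hall s' hb with rfl | h
        · exact Set.mem_insert _ _
        · exact Set.mem_insert_of_mem _ h
      · rintro c (rfl | hc) hcol
        · exact le_rfl
        · by_contra hz
          obtain ⟨j, z, s'⟩ := c
          simp only [not_le] at hcol hz
          subst hcol
          have h1 := (mem_wallOf.1 hc).2.resolve_left (by rintro ⟨h, -⟩; omega)
          have h2 := row_le_top e d z s'
          have h3 := top_antitone e d (show y + 1 ≤ z from hz)
          have h4 := top_succ_le_low e d y
          have h5 := low_le_row e d y s
          omega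
    -- For `y ∈ e` the old full column of height `y` has index `top (y + 1)`, one less than `low y`,
    -- whereas the new block lies at `low y` or further right.
    have hne : i ≠ top e d (y + 1) := by
      have h1 := low_le_row e d y s
      rw [low, if_pos he] at h1
      omega
    have hfull' : IsFullColumn n (insert ⟨i, y, s⟩ (wallOf n e d)) (top e d (y + 1)) y := by
      obtain ⟨h1, h2⟩ := (isFullColumn_wallOf (n := n) hd).2 ⟨he, rfl⟩
      constructor
      · intro b hb hc hl
        exact Set.mem_insert_of_mem _ (h1 b hb hc hl)
      · rintro b (rfl | hb) hcol
        · exact le_rfl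
        · exact h2 b hb hcol
    exact hne (hY.proper _ _ _ hfull hfull')
  · rintro ⟨hp, hg, hi, hbelow, hall⟩
    have hnot : (⟨i, y, s⟩ : Block) ∉ wallOf n e d := by
      intro h
      have := (mem_wallOf.1 h).2.resolve_left hg
      omega
    have hno : ∀ c ∈ wallOf n e d, c.col = i → c.lev ≤ y := by
      rintro ⟨j, z, s'⟩ hc rfl
      by_contra hz
      have hz : y < z := by simpa using hz
      have h1 := (mem_wallOf.1 hc).2.resolve_left (by rintro ⟨h, -⟩; omega)
      have h2 := row_le_top e d z s'
      have h3 := top_antitone e d (show y + 1 ≤ z from hz)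
      have h4 := top_succ_le_low e d y
      have h5 := low_le_row e d y s
      simp only at hi
      omega
    refine ⟨hp, hnot, ?_, ?_, ?_, ?_, ?_, ?_⟩
    · exact Set.insert_subset hp hW.subset_pattern
    · exact fun b hb h => Set.mem_insert_of_mem _ (hW.grey_mem b hb h)
    · refine (hW.finite_white.insert ⟨i, y, s⟩).subset ?_
      rintro b ⟨rfl | hb, h⟩
      · exact Set.mem_insert _ _
      · exact Set.mem_insert_of_mem _ ⟨hb, h⟩
    · rintro b (rfl | hb) c hc h1 h2
      · refine Set.mem_insert_of_mem _ ?_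
        simp only at h1 h2
        exact (forall_mem_wallOf hd).2 (hbelow.resolve_left (by omega)) c hc h1 (by omega)
      · exact Set.mem_insert_of_mem _ (hW.column b hb c hc h1 h2)
    · rintro j z s' (h | h)
      · simp only [Block.mk.injEq] at h
        obtain ⟨h, rfl, rfl⟩ := h
        refine Set.mem_insert_of_mem _ (mem_wallOf.2 ⟨hp, Or.inr ?_⟩)
        omega
      · exact Set.mem_insert_of_mem _ (hW.left _ _ _ h)
    · have key : ∀ j z, IsFullColumn n (insert ⟨i, y, s⟩ (wallOf n e d)) j z → j ≠ i →
          IsFullColumn n (wallOf n e d) j z := by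
        rintro j z ⟨h1, h2⟩ hj
        refine ⟨fun b hb hc hl => ?_, fun b hb hc => h2 b (Set.mem_insert_of_mem _ hb) hc⟩
        rcases h1 b hb hc hl with rfl | h
        · exact absurd hc.symm hj
        · exact h
      have main : ∀ j z, IsFullColumn n (insert ⟨i, y, s⟩ (wallOf n e d)) i z →
          IsFullColumn n (wallOf n e d) j z → False := by
        rintro j z ⟨h1, h2⟩ h3
        have hyz : y ≤ z := h2 ⟨i, y, s⟩ (Set.mem_insert _ _) rfl
        have hzy : z ≤ y := by
          obtain ⟨s', hs'⟩ := exists_mem_pattern n i z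
          rcases h1 _ hs' rfl rfl with h | h
          · simp only [Block.mk.injEq] at h
            exact h.2.1.le
          · exact hno _ h rfl
        obtain rfl : z = y := le_antisymm hzy hyz
        refine hall ?_ ((isFullColumn_wallOf hd).1 h3).1
        intro s' hs'
        rcases h1 _ hs' rfl rfl with h | h
        · simp only [Block.mk.injEq, true_and] at h
          exact Or.inl h
        · exact Or.inr h
      intro j k z hj hk
      by_cases h1 : j = i <;> by_cases h2 : k = i
      · rw [h1, h2]
      · subst h1
        exact (main k z hj (key k z hk h2)).elim
      · subst h2
        exact (main j z hk (key j z hj h1)).elim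
      · exact hW.proper _ _ _ (key j z hj h1) (key k z hk h2)

/-- Half-blocks are absent at such a level, so there is room above the row below exactly if `y - 1 ∈
e`; the new block always completes a full column. -/
theorem isSalient_square_iff (hd : HalfSupported n d) {i y : ℕ} :
    IsSalient n (wallOf n e d) ⟨i, y, .square⟩ ↔
      ¬ (n - 2) ∣ y ∧ i = low e d y ∧ y - 1 ∈ e ∧ y ∉ e := by
  rw [isSalient_wallOf_iff hd, mem_pattern_square, row_square]
  refine and_congr_right fun hy => ?_
  have h0 : y ≠ 0 := by rintro rfl; exact hy (dvd_zero _)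
  obtain ⟨z, rfl⟩ : ∃ z, y = z + 1 := ⟨y - 1, by omega⟩
  have hall : ∀ s', (⟨i, z + 1, s'⟩ : Block) ∈ pattern n → s' = .square ∨
      (⟨i, z + 1, s'⟩ : Block) ∈ wallOf n e d := by
    intro s' hs'
    cases s'
    · exact Or.inl rfl
    · exact absurd (mem_pattern_upper.1 hs') hy
    · exact absurd (mem_pattern_lower.1 hs') hy
  have ht : top e d (z + 1) = low e d (z + 1) := top_of_eq_zero (hd.eq_zero hy)
  have hl : low e d z = (if z ∈ e then 1 else 0) + top e d (z + 1) := rfl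
  constructor
  · rintro ⟨-, h1, h2, h3⟩
    refine ⟨h1, ?_, h3 hall⟩
    by_contra h4
    rw [if_neg (by simpa using h4)] at hl
    simp only [Nat.add_eq_zero_iff, one_ne_zero, and_false, false_or, Nat.add_sub_cancel] at h2
    omega
  · rintro ⟨h1, h2, h3⟩
    rw [if_pos (by simpa using h2)] at hl
    refine ⟨by simp, h1, Or.inr ?_, fun _ => h3⟩
    rw [Nat.add_sub_cancel]
    omega

/-- A half-block completes a full column only if the complementary row is longer; only then does
properness restrict it. -/
theorem isSalient_half_iff (hd : HalfSupported n d) {i y : ℕ} {s : Shape} (hs : s ≠ .square)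
    (hy0 : y ≠ 0) : IsSalient n (wallOf n e d) ⟨i, y, s⟩ ↔
      (n - 2) ∣ y ∧ i = row e d y s ∧ row e d y s < low e d (y - 1) ∧
      (row e d y s < row e d y s.flip → y ∉ e) := by
  rw [isSalient_wallOf_iff hd, mem_pattern_of_ne_square hs]
  refine and_congr_right fun hy => ?_
  have hall : (∀ s', (⟨i, y, s'⟩ : Block) ∈ pattern n → s' = s ∨
      (⟨i, y, s'⟩ : Block) ∈ wallOf n e d) ↔ i < row e d y s.flip := by
    have hp : (⟨i, y, s.flip⟩ : Block) ∈ pattern n :=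
      (mem_pattern_of_ne_square (by cases s <;> simp_all [Shape.flip])).2 hy
    constructor
    · intro h
      rcases h _ hp with h1 | h1
      · exfalso
        cases s <;> simp_all [Shape.flip]
      · exact (mem_wallOf.1 h1).2.resolve_left (by simp [hy0])
    · intro h s' hs'
      have hsq : s' ≠ .square := by
        rintro rfl
        exact mem_pattern_square.1 hs' hy
      by_cases h1 : s' = s
      · exact Or.inl h1
      · refine Or.inr (mem_wallOf.2 ⟨hs', Or.inr ?_⟩)
        have : s' = s.flip := by cases s <;> cases s' <;> simp_all [Shape.flip]
        rwa [this]
  rw [hall]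
  simp only [hy0, false_and, not_false_eq_true, true_and, false_or]
  constructor
  · rintro ⟨rfl, h1, h2⟩; exact ⟨rfl, h1, h2⟩
  · rintro ⟨rfl, h1, h2⟩; exact ⟨rfl, h1, h2⟩

theorem isSalient_zero_iff (hd : HalfSupported n d) {i : ℕ} {s : Shape} :
    IsSalient n (wallOf n e d) ⟨i, 0, s⟩ ↔ s = .upper ∧ i = low e d 0 ∧ 0 ∉ e := by
  rw [isSalient_wallOf_iff hd]
  cases s
  · simp [mem_pattern_square]
  · have hall : ∀ s', (⟨i, 0, s'⟩ : Block) ∈ pattern n → s' = .upper ∨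
        (⟨i, 0, s'⟩ : Block) ∈ wallOf n e d := by
      intro s' hs'
      cases s'
      · exact absurd (dvd_zero _) (mem_pattern_square.1 hs')
      · exact Or.inl rfl
      · exact Or.inr (mem_wallOf.2 ⟨hs', Or.inl ⟨rfl, rfl⟩⟩)
    simp only [mem_pattern_upper, dvd_zero, true_or, reduceCtorEq, and_false, not_false_eq_true,
      true_and, row_of_eq_zero hd.zero]
    constructor
    · rintro ⟨h1, h2⟩; exact ⟨h1, h2 hall⟩
    · rintro ⟨h1, h2⟩; exact ⟨h1, fun _ => h2⟩
  · simp

end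

/-! ### Distinguished `0`-generated walls in terms of column ends -/

section

variable {n : ℕ} {e : Finset ℕ} {d : ℕ →₀ ℤ}

theorem dvd_iff_mod_period (hn : 4 ≤ n) (y : ℕ) :
    (n - 2) ∣ y ↔ y % (2 * n - 4) = 0 ∨ y % (2 * n - 4) = n - 2 := by
  have hL : 2 * n - 4 = (n - 2) * 2 := by omega
  constructor
  · rintro ⟨c, rfl⟩
    rw [hL, Nat.mul_mod_mul_left]
    rcases Nat.mod_two_eq_zero_or_one c with h | h <;> simp [h]
  · intro h
    rw [← Nat.div_add_mod y (2 * n - 4)]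
    refine dvd_add (Dvd.dvd.mul_right (by rw [hL]; exact dvd_mul_right _ _) _) ?_
    rcases h with h | h <;> simp [h]

theorem not_dvd_succ (hn : 4 ≤ n) {y : ℕ} (h : (n - 2) ∣ y) : ¬ (n - 2) ∣ y + 1 := by
  intro h'
  have := (Nat.dvd_add_right h).1 h'
  have := Nat.le_of_dvd one_pos this
  omega

theorem label_of_not_dvd (hn : 4 ≤ n) {b : Block} (h : ¬ (n - 2) ∣ b.lev) :
    2 ≤ label n b ∧ label n b ≤ n - 2 := by
  rw [dvd_iff_mod_period hn, not_or] at h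
  have hlt : b.lev % (2 * n - 4) < 2 * n - 4 := Nat.mod_lt _ (by omega)
  unfold label
  rw [if_neg h.1, if_neg h.2]
  split_ifs <;> omega

theorem label_of_mod_eq_zero {b : Block} (h : b.lev % (2 * n - 4) = 0) :
    label n b = b.halfIndex := by simp [label, h]

theorem label_of_mod_eq (hn : 4 ≤ n) {b : Block} (h : b.lev % (2 * n - 4) = n - 2) :
    label n b = n - 1 + b.halfIndex := by
  unfold label
  rw [if_neg (by omega), if_pos h]

theorem halfIndex_le (b : Block) : b.halfIndex ≤ 1 := by
  rcases b with ⟨i, y, s⟩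
  cases s <;> simp only [Block.halfIndex] <;> omega

theorem flip_ne_square {s : Shape} (hs : s ≠ .square) : s.flip ≠ .square := by
  cases s <;> simp_all [Shape.flip]

theorem flip_flip (s : Shape) : s.flip.flip = s := by cases s <;> rfl

theorem row_add_row_flip {y : ℕ} {s : Shape} (hs : s ≠ .square) :
    (row e d y s = low e d y ∧ row e d y s.flip = top e d y) ∨
      (row e d y s = top e d y ∧ row e d y s.flip = low e d y) := by
  rw [top_eq, ← natAbs_twist e]
  cases s
  · exact absurd rfl hs
  · simp only [row, side, Shape.flip]; omega
  · simp only [row, side, Shape.flip]; omega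

theorem low_lt_top_iff {y : ℕ} : low e d y < top e d y ↔ d y ≠ 0 := by
  rw [top_eq]; omega

theorem exists_shape_row_eq_low (e : Finset ℕ) (d : ℕ →₀ ℤ) (y : ℕ) :
    ∃ s : Shape, s ≠ .square ∧ row e d y s = low e d y ∧ row e d y s.flip = top e d y := by
  rcases row_add_row_flip (e := e) (d := d) (y := y) (s := .upper) (by simp) with h | h
  · exact ⟨.upper, by simp, h⟩
  · exact ⟨.lower, by simp, h.2, h.1⟩

theorem low_pred {y : ℕ} (hy : y ≠ 0) :
    low e d (y - 1) = (if y - 1 ∈ e then 1 else 0) + top e d y := by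
  rw [low, Nat.sub_add_cancel (Nat.pos_of_ne_zero hy)]

theorem ne_zero_of_mod (hn : 4 ≤ n) {y : ℕ} (hy : y % (2 * n - 4) = n - 2) : y ≠ 0 := by
  rintro rfl
  rw [Nat.zero_mod] at hy
  omega

/-- If `d y ≠ 0`, the two rows have different lengths, so no salient pair at one position exists.
The next half-block of the shorter row is then salient unless properness blocks it, that is unless
`y ∈ e`; that of the longer row is salient exactly if `y - 1 ∈ e`. If `d y = 0` and `y - 1 ∈ e`,
both halves at column `low y` are salient, and direct support says that the previous column has no
block at level `y + 1`, which amounts to `y ∈ e`. -/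
theorem upperLabels_iff (hn : 4 ≤ n) (hd : HalfSupported n d) :
    (∀ b, IsSalient n (wallOf n e d) b → label n b = n - 1 ∨ label n b = n →
      IsSalient n (wallOf n e d) b.flip ∧ IsDirectlySupported n (wallOf n e d) b ∧
        IsDirectlySupported n (wallOf n e d) b.flip) ↔
    ∀ y, y % (2 * n - 4) = n - 2 → (d y ≠ 0 → y ∈ e) ∧ (y - 1 ∈ e → d y = 0 ∧ y ∈ e) := by
  constructor
  · intro H y hy
    have hdvd := (dvd_iff_mod_period hn y).2 (Or.inr hy)
    have hy0 := ne_zero_of_mod hn hy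
    have H' : ∀ i s, s ≠ .square → IsSalient n (wallOf n e d) ⟨i, y, s⟩ →
        IsSalient n (wallOf n e d) ⟨i, y, s.flip⟩ ∧
        IsDirectlySupported n (wallOf n e d) ⟨i, y, s⟩ := by
      intro i s hs hsal
      have h1 := halfIndex_le ⟨i, y, s⟩
      have h2 := H _ hsal (by rw [label_of_mod_eq hn hy]; omega)
      exact ⟨h2.1, h2.2.1⟩
    have hl := low_pred (e := e) (d := d) hy0
    obtain ⟨s, hs, h1, h2⟩ := exists_shape_row_eq_low e d y
    constructor
    · intro h0
      by_contra hye
      have h3 := (low_lt_top_iff (e := e)).2 h0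
      have hsal : IsSalient n (wallOf n e d) ⟨low e d y, y, s⟩ :=
        (isSalient_half_iff hd hs hy0).2 ⟨hdvd, h1.symm, by omega, fun _ => hye⟩
      have := ((isSalient_half_iff hd (flip_ne_square hs) hy0).1 (H' _ _ hs hsal).1).2.1
      omega
    · intro hye
      rw [if_pos hye] at hl
      have hsal : IsSalient n (wallOf n e d) ⟨top e d y, y, s.flip⟩ := by
        refine (isSalient_half_iff hd (flip_ne_square hs) hy0).2
          ⟨hdvd, h2.symm, by omega, fun h => ?_⟩
        rw [flip_flip, h1, h2] at h
        exact absurd (low_le_top e d y) (not_le.2 h)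
      obtain ⟨h3, -, -, -, ⟨j, z, s'⟩, hc, hc', h4, h5⟩ := H' _ _ (flip_ne_square hs) hsal
      rw [flip_flip] at h3
      have h6 := ((isSalient_half_iff hd hs hy0).1 h3).2.1
      have h0 : d y = 0 := by
        by_contra h0
        have := (low_lt_top_iff (e := e)).2 h0
        omega
      refine ⟨h0, ?_⟩
      by_contra hye'
      simp only at h4 h5
      subst h5
      apply hc'
      refine mem_wallOf.2 ⟨hc, Or.inr ?_⟩
      have h7 := hd.eq_zero (not_dvd_succ hn hdvd)
      rw [row_of_eq_zero h7, ← top_of_eq_zero h7]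
      have h8 : low e d y = top e d (y + 1) := by simp [low, hye']
      omega
  · rintro H ⟨i, y, s⟩ hsal hlab
    have hy : y % (2 * n - 4) = n - 2 := by
      by_contra hne
      by_cases hdvd : (n - 2) ∣ y
      · have h1 := ((dvd_iff_mod_period hn y).1 hdvd).resolve_right hne
        have h2 := halfIndex_le ⟨i, y, s⟩
        rw [label_of_mod_eq_zero h1] at hlab
        omega
      · have := label_of_not_dvd hn (b := ⟨i, y, s⟩) hdvd
        omega
    have hdvd := (dvd_iff_mod_period hn y).2 (Or.inr hy)
    have hy0 := ne_zero_of_mod hn hy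
    have hl := low_pred (e := e) (d := d) hy0
    have hs : s ≠ .square := by
      rintro rfl
      exact mem_pattern_square.1 hsal.1 hdvd
    obtain ⟨-, h1, h2, h3⟩ := (isSalient_half_iff hd hs hy0).1 hsal
    have hrow := row_add_row_flip (e := e) (d := d) (y := y) hs
    have h0 : d y = 0 := by
      by_contra h0
      have hye := (H y hy).1 h0
      have hye' : y - 1 ∉ e := fun h => h0 ((H y hy).2 h).1
      have := (low_lt_top_iff (e := e)).2 h0
      rw [if_neg hye'] at hl
      rcases hrow with h | h
      · exact h3 (by omega) hye
      · omega
    have hlt := top_of_eq_zero (e := e) h0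
    have hye' : y - 1 ∈ e := by
      by_contra h
      rw [if_neg h] at hl
      omega
    have hye := ((H y hy).2 hye').2
    have hsal' : IsSalient n (wallOf n e d) ⟨i, y, s.flip⟩ := by
      refine (isSalient_half_iff hd (flip_ne_square hs) hy0).2 ⟨hdvd, by omega, by omega, ?_⟩
      rw [flip_flip]
      omega
    have hbelow : ∀ c ∈ pattern n, c.col = i → c.lev + 1 = y → c ∈ wallOf n e d := by
      intro c hc hci hcy
      refine (forall_mem_wallOf hd (i := i) (y := y - 1)).2 (by omega) c hc hci (by omega)
    have hleft : ∃ c ∈ pattern n, c ∉ wallOf n e d ∧ c.col + 1 = i ∧ c.lev = y + 1 := by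
      have h4 : low e d y = 1 + top e d (y + 1) := by rw [low, if_pos hye]
      refine ⟨⟨top e d (y + 1), y + 1, .square⟩, mem_pattern_square.2 (not_dvd_succ hn hdvd),
        fun h => ?_, by simp only; omega, rfl⟩
      have h5 := (mem_wallOf.1 h).2.resolve_left (by simp)
      exact absurd (row_le_top e d (y + 1) .square) (not_le.2 h5)
    refine ⟨hsal', ⟨hsal.2.1, hsal'.2.1, hbelow, hleft⟩, ⟨hsal'.2.1, ?_, hbelow, hleft⟩⟩
    simpa only [Block.flip, flip_flip] using hsal.2.1

theorem label_upper {i y : ℕ} (hy : y % (2 * n - 4) = 0) :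
    label n ⟨i, y, .upper⟩ = i % 2 := label_of_mod_eq_zero (b := ⟨i, y, .upper⟩) hy

theorem label_lower {i y : ℕ} (hy : y % (2 * n - 4) = 0) :
    label n ⟨i, y, .lower⟩ = (i + 1) % 2 := label_of_mod_eq_zero (b := ⟨i, y, .lower⟩) hy

theorem twist_eq_or (e : Finset ℕ) (d : ℕ →₀ ℤ) (y : ℕ) :
    (low e d y % 2 = 0 ∧ twist e d y = d y) ∨ (low e d y % 2 = 1 ∧ twist e d y = -d y) := by
  rcases Nat.mod_two_eq_zero_or_one (low e d y) with h | h
  · exact Or.inl ⟨h, twist_of_even h⟩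
  · exact Or.inr ⟨h, twist_of_odd h⟩

/-- Here `M = low y`, `z` is the twisted and `D` the untwisted number of half-blocks, `P` is `y - 1
∈ e` and `Q` is `y ∈ e`. Labels alternate along a row, and `0 < D` means that the series begins with
label `0`. The next half-block of the longer row fits exactly under `P`, and the condition on sign
and parity of `D` says that its label is not `1`; for `D = 0` both labels would be available. The
next one in the shorter row has label `1` exactly if `0 < D` (when `D ≠ 0`), and only `Q` can block
it. -/
theorem half_label_arith {M : ℕ} {z D : ℤ} {P Q : Prop} [Decidable P]
    (h : (M % 2 = 0 ∧ z = D) ∨ (M % 2 = 1 ∧ z = -D)) :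
    ((M + z.toNat < (if P then 1 else 0) + (D.natAbs + M) ∧ (M + z.toNat < M + (-z).toNat → ¬ Q) →
        (M + z.toNat) % 2 ≠ 1) ∧
      (M + (-z).toNat < (if P then 1 else 0) + (D.natAbs + M) ∧
        (M + (-z).toNat < M + z.toNat → ¬ Q) → (M + (-z).toNat + 1) % 2 ≠ 1)) ↔
      (P → D ≠ 0 ∧ (0 < D ↔ D % 2 = 0)) ∧ (0 < D → Q) := by
  obtain ⟨k, hk⟩ : ∃ k : ℕ, D.natAbs = k := ⟨_, rfl⟩
  have huv : (z.toNat = 0 ∧ (-z).toNat = 0 ∧ D = 0 ∧ k = 0) ∨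
      (z.toNat = k ∧ (-z).toNat = 0 ∧ 0 < k ∧ ((M % 2 = 0 ∧ D = k) ∨ (M % 2 = 1 ∧ D = -k))) ∨
      (z.toNat = 0 ∧ (-z).toNat = k ∧ 0 < k ∧ ((M % 2 = 1 ∧ D = k) ∨ (M % 2 = 0 ∧ D = -k))) := by
    omega
  rw [hk]
  generalize z.toNat = u at *
  generalize (-z).toNat = v at *
  clear h hk
  rcases huv with ⟨rfl, rfl, rfl, rfl⟩ | ⟨rfl, rfl, h0, ⟨h1, rfl⟩ | ⟨h1, rfl⟩⟩ |
    ⟨rfl, rfl, h0, ⟨h1, rfl⟩ | ⟨h1, rfl⟩⟩ <;>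
  by_cases hP : P <;> by_cases hQ : Q <;> simp [hP, hQ] <;> omega

theorem lowerLabels_half_iff (hn : 4 ≤ n) (hd : HalfSupported n d) {y : ℕ} (hy0 : y ≠ 0)
    (hy : y % (2 * n - 4) = 0) :
    (∀ i s, IsSalient n (wallOf n e d) ⟨i, y, s⟩ → label n ⟨i, y, s⟩ ≠ 1) ↔
      (y - 1 ∈ e → d y ≠ 0 ∧ (0 < d y ↔ d y % 2 = 0)) ∧ (0 < d y → y ∈ e) := by
  have hdvd := (dvd_iff_mod_period hn y).2 (Or.inl hy)
  have hl := low_pred (e := e) (d := d) hy0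
  have htop := top_eq e d y
  have htw := twist_eq_or e d y
  have hall : (∀ i s, IsSalient n (wallOf n e d) ⟨i, y, s⟩ → label n ⟨i, y, s⟩ ≠ 1) ↔
      ((row e d y .upper < low e d (y - 1) ∧ (row e d y .upper < row e d y .lower → y ∉ e) →
        row e d y .upper % 2 ≠ 1) ∧
      (row e d y .lower < low e d (y - 1) ∧ (row e d y .lower < row e d y .upper → y ∉ e) →
        (row e d y .lower + 1) % 2 ≠ 1)) := by
    constructor
    · intro H
      constructor
      · rintro ⟨h1, h2⟩
        rw [← label_upper hy]
        exact H _ _ ((isSalient_half_iff hd (by simp) hy0).2 ⟨hdvd, rfl, h1, h2⟩)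
      · rintro ⟨h1, h2⟩
        rw [← label_lower hy]
        exact H _ _ ((isSalient_half_iff hd (by simp) hy0).2 ⟨hdvd, rfl, h1, h2⟩)
    · rintro ⟨H1, H2⟩ i s hsal
      cases s
      · exact absurd hdvd (mem_pattern_square.1 hsal.1)
      · obtain ⟨-, rfl, h1, h2⟩ := (isSalient_half_iff hd (by simp) hy0).1 hsal
        rw [label_upper hy]
        exact H1 ⟨h1, h2⟩
      · obtain ⟨-, rfl, h1, h2⟩ := (isSalient_half_iff hd (by simp) hy0).1 hsal
        rw [label_lower hy]
        exact H2 ⟨h1, h2⟩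
  rw [hall, hl, htop]
  exact half_label_arith htw

/-- The three clauses treat full blocks, positive levels with labels `0, 1`, and level `0`. In the
last case the only candidate is the upper half in column `top e d 0`; its label is the parity of
that column, and it is blocked exactly if `0 ∈ e`. -/
theorem lowerLabels_iff (hn : 4 ≤ n) (hd : HalfSupported n d) :
    (∀ b, IsSalient n (wallOf n e d) b → label n b ∉ Set.Icc 1 (n - 2)) ↔
      (∀ y, ¬ (n - 2) ∣ y → y - 1 ∈ e → y ∈ e) ∧
      (∀ y, y ≠ 0 → y % (2 * n - 4) = 0 →
        (y - 1 ∈ e → d y ≠ 0 ∧ (0 < d y ↔ d y % 2 = 0)) ∧ (0 < d y → y ∈ e)) ∧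
      (0 ∉ e → top e d 0 % 2 = 0) := by
  have ht0 : top e d 0 = low e d 0 := top_of_eq_zero hd.zero
  constructor
  · intro H
    refine ⟨fun y hy hye => ?_, fun y hy0 hy => ?_, fun h0 => ?_⟩
    · by_contra hye'
      have h1 := label_of_not_dvd hn (b := ⟨low e d y, y, .square⟩) hy
      exact H _ ((isSalient_square_iff hd).2 ⟨hy, rfl, hye, hye'⟩) ⟨by omega, h1.2⟩
    · rw [← lowerLabels_half_iff hn hd hy0 hy]
      intro i s hsal hlab
      exact H _ hsal ⟨hlab.ge, by omega⟩
    · have h1 := H _ ((isSalient_zero_iff hd).2 ⟨rfl, rfl, h0⟩)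
      rw [label_upper (Nat.zero_mod _), Set.mem_Icc] at h1
      omega
  · rintro ⟨H1, H2, H3⟩ ⟨i, y, s⟩ hsal hlab
    by_cases hdvd : (n - 2) ∣ y
    · rcases (dvd_iff_mod_period hn y).1 hdvd with hy | hy
      · have h1 := halfIndex_le ⟨i, y, s⟩
        have h2 : label n ⟨i, y, s⟩ = 1 := by
          have h3 := hlab.1
          rw [label_of_mod_eq_zero hy] at h3 ⊢
          omega
        by_cases hy0 : y = 0
        · subst hy0
          obtain ⟨rfl, rfl, h0⟩ := (isSalient_zero_iff hd).1 hsal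
          rw [label_upper hy] at h2
          have := H3 h0
          omega
        · exact (lowerLabels_half_iff hn hd hy0 hy).2 (H2 y hy0 hy) i s hsal h2
      · have h1 := hlab.2
        rw [label_of_mod_eq hn hy] at h1
        omega
    · cases s
      · obtain ⟨-, -, h1, h2⟩ := (isSalient_square_iff hd).1 hsal
        exact h2 (H1 y hdvd h1)
      · exact hdvd (mem_pattern_upper.1 hsal.1)
      · exact hdvd (mem_pattern_lower.1 hsal.1)

theorem endsInHalf_wallOf_iff {i y : ℕ} (hy0 : y ≠ 0)
    (hy : (n - 2) ∣ y) :
    EndsInHalf (wallOf n e d) i y ↔ low e d y ≤ i ∧ i < top e d y := by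
  have key : ∀ s : Shape, s ≠ .square → ((⟨i, y, s⟩ : Block) ∈ wallOf n e d ↔ i < row e d y s) := by
    intro s hs
    rw [mem_wallOf, mem_pattern_of_ne_square hs]
    simp [hy, hy0]
  constructor
  · rintro ⟨⟨j, z, s⟩, hb, rfl, rfl, hs, hf⟩
    have h1 : j < row e d z s := (key s hs).1 hb
    have h2 : ¬ j < row e d z s.flip := fun h => hf ((key s.flip (flip_ne_square hs)).2 h)
    have h3 := low_le_top e d z
    change low e d z ≤ j ∧ j < top e d z
    rcases row_add_row_flip (e := e) (d := d) (y := z) hs with ⟨h4, h5⟩ | ⟨h4, h5⟩ <;>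
      rw [h4] at h1 <;> rw [h5] at h2 <;> omega
  · rintro ⟨h1, h2⟩
    obtain ⟨s, hs, h3, h4⟩ := exists_shape_row_eq_low e d y
    refine ⟨⟨i, y, s.flip⟩, (key _ (flip_ne_square hs)).2 (by omega), rfl, rfl,
      flip_ne_square hs, ?_⟩
    simp only [Block.flip, flip_flip]
    rw [key s hs]
    omega

/-- The distinguished `0`-generated walls in terms of the ends of their columns. -/
theorem isDistinguished_wallOf_iff (hn : 4 ≤ n) (hd : HalfSupported n d) :
    IsDistinguished n (wallOf n e d) ↔
      (∀ y, y % (2 * n - 4) = n - 2 → (d y ≠ 0 → y ∈ e ∧ n - 1 < (d y).natAbs) ∧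
        (y - 1 ∈ e → d y = 0 ∧ y ∈ e)) ∧
      (∀ y, ¬ (n - 2) ∣ y → y - 1 ∈ e → y ∈ e) ∧
      (∀ y, y ≠ 0 → y % (2 * n - 4) = 0 →
        (y - 1 ∈ e → d y ≠ 0 ∧ (0 < d y ↔ d y % 2 = 0)) ∧ (0 < d y → y ∈ e)) ∧
      (0 ∉ e → top e d 0 % 2 = 0) := by
  have hser : (∀ y, y % (2 * n - 4) = n - 2 → (∃ i, EndsInHalf (wallOf n e d) i y) →
      n - 1 < {i | EndsInHalf (wallOf n e d) i y}.ncard) ↔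
      ∀ y, y % (2 * n - 4) = n - 2 → d y ≠ 0 → n - 1 < (d y).natAbs := by
    refine forall_congr' fun y => forall_congr' fun hy => ?_
    have hiff := fun i => endsInHalf_wallOf_iff (e := e) (d := d) (i := i) (ne_zero_of_mod hn hy)
      ((dvd_iff_mod_period hn y).2 (Or.inr hy))
    have hset : {i | EndsInHalf (wallOf n e d) i y}
        = (↑(Finset.Ico (low e d y) (top e d y)) : Set ℕ) := by
      ext i; rw [Finset.coe_Ico]; exact hiff i
    rw [hset, Set.ncard_coe_finset, Nat.card_Ico]
    have h1 := top_eq e d y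
    refine imp_congr ?_ (by omega)
    constructor
    · rintro ⟨i, hi⟩
      have := (hiff i).1 hi
      omega
    · intro h
      exact ⟨low e d y, (hiff _).2 ⟨le_rfl, low_lt_top_iff.2 h⟩⟩
  unfold IsDistinguished IsZeroGenerated
  rw [hser, upperLabels_iff hn hd, lowerLabels_iff hn hd]
  constructor
  · rintro ⟨⟨h1, h2⟩, h3⟩
    exact ⟨fun y hy => ⟨fun h => ⟨(h1 y hy).1 h, h3 y hy h⟩, (h1 y hy).2⟩, h2⟩
  · rintro ⟨h1, h2⟩
    exact ⟨⟨fun y hy => ⟨fun h => ((h1 y hy).1 h).1, (h1 y hy).2⟩, h2⟩,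
      fun y hy h => ((h1 y hy).1 h).2⟩

end

/-! ### The number of white blocks and the `0`-weight -/

section

variable {n : ℕ} {e : Finset ℕ} {d : ℕ →₀ ℤ}

open Classical in
/-- The number of white blocks of shape `s` and level `y` with a given property. -/
noncomputable def rowCount (n : ℕ) (e : Finset ℕ) (d : ℕ →₀ ℤ) (P : Block → Prop) (y : ℕ)
    (s : Shape) : ℕ :=
  if (⟨0, y, s⟩ : Block) ∈ pattern n ∧ ¬ (y = 0 ∧ s = .lower) then
    ((Finset.range (row e d y s)).filter fun i => P ⟨i, y, s⟩).card else 0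

theorem ncard_white {H : ℕ} (hH : ∀ y, H ≤ y → y ∉ e ∧ d y = 0) (P : Block → Prop) :
    {b ∈ wallOf n e d | ¬ b.IsGrey ∧ P b}.ncard = ∑ y ∈ Finset.range H,
      (rowCount n e d P y .square + rowCount n e d P y .upper + rowCount n e d P y .lower) := by
  classical
  let valid : ℕ × Shape → Prop := fun x =>
    (⟨0, x.1, x.2⟩ : Block) ∈ pattern n ∧ ¬ (x.1 = 0 ∧ x.2 = .lower)
  let T : Finset (Σ _ : ℕ × Shape, ℕ) :=
    ((Finset.range H ×ˢ ({.square, .upper, .lower} : Finset Shape)).filter valid).sigma fun x =>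
      (Finset.range (row e d x.1 x.2)).filter fun i => P ⟨i, x.1, x.2⟩
  let f : (Σ _ : ℕ × Shape, ℕ) → Block := fun x => ⟨x.2, x.1.1, x.1.2⟩
  have hf : Function.Injective f := by
    rintro ⟨⟨y, s⟩, i⟩ ⟨⟨y', s'⟩, i'⟩ h
    simp only [f, Block.mk.injEq] at h
    obtain ⟨rfl, rfl, rfl⟩ := h
    rfl
  have hset : {b ∈ wallOf n e d | ¬ b.IsGrey ∧ P b} = (↑(T.image f) : Set Block) := by
    ext ⟨i, y, s⟩
    rw [Finset.mem_coe, Finset.mem_image]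
    constructor
    · rintro ⟨hb, hg, hP⟩
      have h1 := (mem_wallOf.1 hb).2.resolve_left hg
      have h2 : y < H := by
        by_contra hy
        have := row_le_top e d y s
        rw [top_eq_zero hH (not_lt.1 hy)] at this
        omega
      refine ⟨⟨⟨y, s⟩, i⟩, ?_, rfl⟩
      simp only [T, Finset.mem_sigma, Finset.mem_filter, Finset.mem_product, Finset.mem_range]
      exact ⟨⟨⟨h2, by cases s <;> simp⟩, hb.1, hg⟩, h1, hP⟩
    · rintro ⟨⟨⟨y', s'⟩, i'⟩, hx, h⟩
      simp only [f, Block.mk.injEq] at h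
      obtain ⟨rfl, rfl, rfl⟩ := h
      simp only [T, Finset.mem_sigma, Finset.mem_filter, Finset.mem_product,
        Finset.mem_range] at hx
      exact ⟨⟨hx.1.2.1, Or.inr hx.2.1⟩, hx.1.2.2, hx.2.2⟩
  rw [hset, Set.ncard_coe_finset, Finset.card_image_of_injective _ hf, Finset.card_sigma,
    Finset.sum_filter, Finset.sum_product]
  refine Finset.sum_congr rfl fun y _ => ?_
  rw [Finset.sum_insert (by simp), Finset.sum_insert (by simp), Finset.sum_singleton, ← add_assoc]
  rfl

theorem card_filter_even (m : ℕ) : ((Finset.range m).filter fun i => i % 2 = 0).card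
    = (m + 1) / 2 := by
  induction m with
  | zero => simp
  | succ m ih =>
    rw [Finset.range_add_one, Finset.filter_insert]
    split_ifs with h
    · rw [Finset.card_insert_of_notMem (by simp), ih]; omega
    · rw [ih]; omega

theorem card_filter_odd (m : ℕ) : ((Finset.range m).filter fun i => (i + 1) % 2 = 0).card
    = m / 2 := by
  induction m with
  | zero => simp
  | succ m ih =>
    rw [Finset.range_add_one, Finset.filter_insert]
    split_ifs with h
    · rw [Finset.card_insert_of_notMem (by simp), ih]; omega
    · rw [ih]; omega

/-- The number of white blocks and half-blocks of a set of blocks. -/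
noncomputable def whites (Y : Set Block) : ℕ := {b ∈ Y | ¬ b.IsGrey}.ncard

theorem whites_wallOf {H : ℕ} (hd : HalfSupported n d) (hH : ∀ y, H ≤ y → y ∉ e ∧ d y = 0) :
    whites (wallOf n e d) = ∑ y ∈ Finset.range H,
      ((if (n - 2) ∣ y ∧ y ≠ 0 then 2 else 1) * low e d y + (d y).natAbs) := by
  have h := ncard_white (n := n) hH (fun _ => True)
  simp only [and_true] at h
  rw [whites, h]
  refine Finset.sum_congr rfl fun y _ => ?_
  simp only [rowCount, mem_pattern_square, mem_pattern_upper, mem_pattern_lower, Finset.filter_true,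
    Finset.card_range, reduceCtorEq, and_false, and_true, not_false_eq_true]
  rw [← natAbs_twist e]
  by_cases h1 : (n - 2) ∣ y
  · by_cases h2 : y = 0
    · subst h2
      simp [row_of_eq_zero hd.zero, natAbs_twist, hd.zero]
    · simp only [h1, h2, row, side, not_true_eq_false, not_false_eq_true, if_true, if_false,
        true_and, ne_eq]
      omega
  · simp [h1, natAbs_twist, hd.eq_zero h1, row, side]

theorem wt_zero_wallOf {H : ℕ} (hn : 4 ≤ n)
    (hH : ∀ y, H ≤ y → y ∉ e ∧ d y = 0) :
    wt n (wallOf n e d) 0 = ∑ y ∈ Finset.range H, if y % (2 * n - 4) = 0 then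
      (row e d y .upper + 1) / 2 + (if y = 0 then 0 else row e d y .lower / 2) else 0 := by
  rw [wt, ncard_white (n := n) hH (fun b => label n b = 0)]
  refine Finset.sum_congr rfl fun y _ => ?_
  by_cases hdvd : (n - 2) ∣ y
  · simp only [rowCount, mem_pattern_square, mem_pattern_upper, mem_pattern_lower, hdvd,
      reduceCtorEq, and_false, and_true, not_false_eq_true, not_true_eq_false, true_and,
      if_true, if_false, zero_add]
    rcases (dvd_iff_mod_period hn y).1 hdvd with hy | hy
    · rw [if_pos hy]
      simp only [label_upper hy, label_lower hy, card_filter_even, card_filter_odd]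
      by_cases h0 : y = 0 <;> simp [h0]
    · have hy' : ¬ y % (2 * n - 4) = 0 := by rw [hy]; omega
      rw [if_neg hy']
      have hlab : ∀ i s, label n ⟨i, y, s⟩ ≠ 0 := by
        intro i s
        rw [label_of_mod_eq hn hy]
        omega
      simp [hlab]
  · rw [if_neg fun h => hdvd ((dvd_iff_mod_period hn y).2 (Or.inl h))]
    have hlab : ∀ i s, label n ⟨i, y, s⟩ ≠ 0 := by
      intro i s h
      have := label_of_not_dvd hn (b := ⟨i, y, s⟩) hdvd
      omega
    simp [rowCount, hlab]

theorem label_le (hn : 4 ≤ n) (b : Block) : label n b ≤ n := by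
  have h := halfIndex_le b
  by_cases hdvd : (n - 2) ∣ b.lev
  · rcases (dvd_iff_mod_period hn _).1 hdvd with hy | hy
    · rw [label_of_mod_eq_zero hy]; omega
    · rw [label_of_mod_eq hn hy]; omega
  · have := label_of_not_dvd hn hdvd
    omega

theorem sum_wt (hn : 4 ≤ n) {Y : Set Block} (hY : IsYoungWall n Y) :
    ∑ j ∈ Finset.range (n + 1), wt n Y j = whites Y := by
  classical
  have hfin := hY.finite_white
  have h1 : ∀ j, wt n Y j = (hfin.toFinset.filter fun b => label n b = j).card := by
    intro j
    rw [wt, ← Set.ncard_coe_finset]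
    congr 1
    ext b
    simp [and_assoc]
  rw [whites, Set.ncard_eq_toFinset_card _ hfin, Finset.sum_congr rfl fun j _ => h1 j]
  exact (Finset.card_eq_sum_card_fiberwise (f := label n) fun b _ => by
    have := label_le hn b
    simp only [Finset.coe_range, Set.mem_Iio]
    omega).symm

theorem succ_div_of_not_dvd {m y : ℕ} (h : ¬ m ∣ y + 1) : (y + 1) / m = y / m := by
  rw [Nat.succ_div, if_neg h, add_zero]

theorem succ_div_of_dvd {m y : ℕ} (h : m ∣ y + 1) : (y + 1) / m = y / m + 1 := by
  rw [Nat.succ_div, if_pos h]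

/-- The total number of white blocks is the sum of the sizes of the columns. -/
theorem whites_wallOf_eq {H : ℕ} (hd : HalfSupported n d)
    (hH : ∀ y, H ≤ y → y ∉ e ∧ d y = 0) :
    whites (wallOf n e d) = ∑ y ∈ Finset.range H,
      ((if y ∈ e then 1 else 0) * (y + y / (n - 2) + 1) + (d y).natAbs * (y + y / (n - 2))) := by
  -- Summation by parts from rows to columns. The last term accounts for the columns that continue
  -- above level `K`: each has `K + K / (n - 2) + 1` white blocks up to there.
  have key : ∀ K, ∑ y ∈ Finset.range (K + 1),
      ((if (n - 2) ∣ y ∧ y ≠ 0 then 2 else 1) * low e d y + (d y).natAbs) =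
      ∑ y ∈ Finset.range (K + 1), ((if y ∈ e then 1 else 0) * (y + y / (n - 2) + 1) +
        (d y).natAbs * (y + y / (n - 2))) + (K + K / (n - 2) + 1) * top e d (K + 1) := by
    intro K
    induction K with
    | zero =>
      simp [hd.zero, low]
    | succ K ih =>
      rw [Finset.sum_range_succ, ih, Finset.sum_range_succ _ (K + 1)]
      have h1 : low e d (K + 1) = (if K + 1 ∈ e then 1 else 0) + top e d (K + 1 + 1) := rfl
      rw [top_eq e d (K + 1), h1]
      by_cases h : (n - 2) ∣ K + 1
      · have h2 : (if (n - 2) ∣ K + 1 ∧ K + 1 ≠ 0 then 2 else 1) = 2 :=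
          if_pos ⟨h, Nat.succ_ne_zero K⟩
        rw [h2, succ_div_of_dvd h]
        ring
      · have h2 : (if (n - 2) ∣ K + 1 ∧ K + 1 ≠ 0 then 2 else 1) = 1 :=
          if_neg fun h' => h h'.1
        rw [h2, succ_div_of_not_dvd h, hd.eq_zero h, Int.natAbs_zero]
        ring
  have hH' : ∀ y, H + 1 ≤ y → y ∉ e ∧ d y = 0 := fun y hy => hH y (by omega)
  rw [whites_wallOf hd hH', key, top_eq_zero hH (Nat.le_succ H), Finset.sum_range_succ,
    if_neg (hH H le_rfl).1, (hH H le_rfl).2]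
  simp

/-! ### Splitting a number of half-blocks into two bits and pairs -/

/-- The first fermionic part of a signed number `D` of columns that end in a single half-block with
label `0` or `1`: we have `|D| = 2 * bosonPart D + betaBit D + gammaBit D`, and `D` is determined by
these three numbers. -/
def betaBit (D : ℤ) : ℕ := if D ≠ 0 ∧ (0 < D ↔ D % 2 = 0) then 1 else 0

/-- The second fermionic part, see `betaBit`. -/
def gammaBit (D : ℤ) : ℕ := if 0 < D then 1 else 0

/-- The bosonic part, see `betaBit`. -/
def bosonPart (D : ℤ) : ℕ := (D.natAbs - betaBit D - gammaBit D) / 2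

theorem natAbs_eq_bits (D : ℤ) : D.natAbs = 2 * bosonPart D + betaBit D + gammaBit D := by
  unfold bosonPart betaBit gammaBit
  split_ifs <;> omega

theorem ext_bits {D D' : ℤ} (h1 : betaBit D = betaBit D') (h2 : gammaBit D = gammaBit D')
    (h3 : bosonPart D = bosonPart D') : D = D' := by
  have h4 := natAbs_eq_bits D
  have h5 := natAbs_eq_bits D'
  unfold betaBit gammaBit at *
  split_ifs at * <;> omega

theorem exists_bits (b c : Bool) (j : ℕ) :
    ∃ D : ℤ, betaBit D = b.toNat ∧ gammaBit D = c.toNat ∧ bosonPart D = j := by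
  have key : ∀ D : ℤ, betaBit D = b.toNat → gammaBit D = c.toNat →
      D.natAbs = 2 * j + b.toNat + c.toNat →
      betaBit D = b.toNat ∧ gammaBit D = c.toNat ∧ bosonPart D = j := by
    intro D h1 h2 h3
    rw [natAbs_eq_bits, h1, h2] at h3
    exact ⟨h1, h2, by omega⟩
  -- Sign and parity encode the bits: nonpositive even, positive odd, negative odd, positive even.
  cases b <;> cases c
  · exact ⟨-(2 * j), key _ (by simp only [betaBit, Bool.toNat_false]; split_ifs <;> omega)
      (by simp only [gammaBit, Bool.toNat_false]; split_ifs <;> omega) (by simp; omega)⟩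
  · exact ⟨2 * j + 1, key _ (by simp only [betaBit, Bool.toNat_false]; split_ifs <;> omega)
      (by simp only [gammaBit, Bool.toNat_true]; split_ifs <;> omega) (by simp; omega)⟩
  · exact ⟨-(2 * j + 1), key _ (by simp only [betaBit, Bool.toNat_true]; split_ifs <;> omega)
      (by simp only [gammaBit, Bool.toNat_false]; split_ifs <;> omega) (by simp; omega)⟩
  · exact ⟨2 * j + 2, key _ (by simp only [betaBit, Bool.toNat_true]; split_ifs <;> omega)
      (by simp only [gammaBit, Bool.toNat_true]; split_ifs <;> omega) (by simp; omega)⟩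

/-- A complete position carries one half-block of label `0`. In the series of single half-blocks the
labels alternate, so half of them have label `0` up to an error for odd length, which is positive if
the series begins with `0`. This error is `gammaBit - betaBit`. -/
theorem two_mul_halves (e : Finset ℕ) (d : ℕ →₀ ℤ) (y : ℕ) :
    (2 * ((row e d y .upper + 1) / 2 + row e d y .lower / 2 : ℕ) : ℤ) =
      2 * low e d y + (d y).natAbs + gammaBit (d y) - betaBit (d y) := by
  have h1 := twist_eq_or e d y
  simp only [row, side]
  generalize low e d y = M at *
  generalize twist e d y = z at *
  generalize d y = D at *
  obtain ⟨k, hk⟩ : ∃ k : ℕ, D = k ∨ D = -k := ⟨D.natAbs, by omega⟩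
  have hb : gammaBit D = 0 ∧ betaBit D = 0 ∧ ((D ≤ 0 ∧ D % 2 = 0)) ∨
      gammaBit D = 0 ∧ betaBit D = 1 ∧ (D < 0 ∧ D % 2 = 1) ∨
      gammaBit D = 1 ∧ betaBit D = 0 ∧ (0 < D ∧ D % 2 = 1) ∨
      gammaBit D = 1 ∧ betaBit D = 1 ∧ (0 < D ∧ D % 2 = 0) := by
    unfold gammaBit betaBit
    split_ifs <;> omega
  rcases hb with ⟨h2, h3, h4, h5⟩ | ⟨h2, h3, h4, h5⟩ | ⟨h2, h3, h4, h5⟩ | ⟨h2, h3, h4, h5⟩ <;>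
    rw [h2, h3] <;> rcases h1 with ⟨h1, rfl⟩ | ⟨h1, rfl⟩ <;> omega

/-- The contribution of the columns ending in a half-block at level `y` to twice the `0`-weight. -/
def halfWeight (n y : ℕ) (D : ℤ) : ℤ :=
  if y % (2 * n - 4) = 0 then 2 * (y / (2 * n - 4) : ℕ) * D.natAbs + gammaBit D - betaBit D
  else (2 * (y / (2 * n - 4) : ℕ) + 1) * D.natAbs

theorem two_mul_wt_zero {H : ℕ} (hn : 4 ≤ n) (hd : HalfSupported n d)
    (hH : ∀ y, H ≤ y → y ∉ e ∧ d y = 0) :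
    (2 * wt n (wallOf n e d) 0 : ℤ) = (top e d 0 % 2 : ℕ) + ∑ y ∈ Finset.range H,
      ((if y ∈ e then 1 else 0) * (2 * (y / (2 * n - 4) : ℕ) + 1) + halfWeight n y (d y)) := by
  -- Again summation by parts. On level `0` only every other column has a white block of label `0`;
  -- doubling the rounded-up half leaves the parity of the number of columns, the first term on the
  -- right.
  have key : ∀ K, ∑ y ∈ Finset.range (K + 1), (2 * ((if y % (2 * n - 4) = 0 then
      (row e d y .upper + 1) / 2 + (if y = 0 then 0 else row e d y .lower / 2) else 0 : ℕ) : ℤ)) =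
      (top e d 0 % 2 : ℕ) + ∑ y ∈ Finset.range (K + 1),
      ((if y ∈ e then 1 else 0) * (2 * (y / (2 * n - 4) : ℕ) + 1) + halfWeight n y (d y)) +
      (2 * (K / (2 * n - 4) : ℕ) + 1) * top e d (K + 1) := by
    intro K
    induction K with
    | zero =>
      have h1 : top e d 0 = low e d 0 := top_of_eq_zero hd.zero
      have h2 : low e d 0 = (if 0 ∈ e then 1 else 0) + top e d 1 := rfl
      have h3 : ((if 0 ∈ e then 1 else 0 : ℕ) : ℤ) = if 0 ∈ e then 1 else 0 := by split_ifs <;> rfl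
      simp only [zero_add, Finset.sum_range_one, Nat.zero_mod, if_true, Nat.zero_div,
        Nat.cast_zero, mul_zero, mul_one, one_mul, halfWeight, hd.zero, Int.natAbs_zero, gammaBit,
        betaBit, row_of_eq_zero hd.zero, h1, add_zero]
      simp only [lt_irrefl, if_false, ne_eq, not_true_eq_false, false_and, Nat.cast_zero]
      rw [← h3]
      omega
    | succ K ih =>
      rw [Finset.sum_range_succ, ih, Finset.sum_range_succ _ (K + 1)]
      have h1 : low e d (K + 1) = (if K + 1 ∈ e then 1 else 0) + top e d (K + 1 + 1) := rfl
      have h2 := top_eq e d (K + 1)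
      have h3 := two_mul_halves e d (K + 1)
      rw [if_neg (Nat.succ_ne_zero K), h2, halfWeight]
      by_cases h : (K + 1) % (2 * n - 4) = 0
      · rw [if_pos h, if_pos h, h3, succ_div_of_dvd (Nat.dvd_of_mod_eq_zero h), h1]
        push_cast
        ring
      · rw [if_neg h, if_neg h, succ_div_of_not_dvd (fun h' => h (Nat.mod_eq_zero_of_dvd h')), h1]
        push_cast
        ring
  have hH' : ∀ y, H + 1 ≤ y → y ∉ e ∧ d y = 0 := fun y hy => hH y (by omega)
  rw [wt_zero_wallOf hn hH', Nat.cast_sum, Finset.mul_sum, key, top_eq_zero hH (Nat.le_succ H),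
    Finset.sum_range_succ, if_neg (hH H le_rfl).1, (hH H le_rfl).2]
  simp [halfWeight, gammaBit, betaBit]

end

/-! ### Layers, and the statistics as sums over layers -/

section

variable {n : ℕ} {e : Finset ℕ} {d : ℕ →₀ ℤ}

/-- The fermionic part of the `a`-th layer of a wall, the part of the wall which ends at the levels
from `a * (2 * n - 4)` to `(a + 1) * (2 * n - 4)`. -/
def layerSet (n : ℕ) (e : Finset ℕ) (d : ℕ →₀ ℤ) (a : ℕ) : Finset ℕ :=
  (Finset.range (2 * n - 2)).filter fun t =>
    if t = 0 then (if a = 0 then top e d 0 % 2 = 1 else 0 < d (a * (2 * n - 4)))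
    else if t = 2 * n - 3 then betaBit (d ((a + 1) * (2 * n - 4))) = 1
    else a * (2 * n - 4) + (t - 1) ∈ e

theorem sum_layerSet (hn : 4 ≤ n) {R : Type*} [CommRing R] (c : ℕ → R) (a : ℕ) :
    ∑ t ∈ layerSet n e d a, c t =
      (if a = 0 then top e d 0 % 2 else gammaBit (d (a * (2 * n - 4))) : ℕ) * c 0 +
      ∑ b ∈ Finset.range (2 * n - 4),
        (if a * (2 * n - 4) + b ∈ e then 1 else 0) * c (b + 1) +
      betaBit (d ((a + 1) * (2 * n - 4))) * c (2 * n - 3) := by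
  obtain ⟨L, hL⟩ : ∃ L, 2 * n - 4 = L := ⟨_, rfl⟩
  rw [layerSet, Finset.sum_filter, show 2 * n - 2 = L + 1 + 1 by omega,
    show 2 * n - 3 = L + 1 by omega, hL, Finset.sum_range_succ, Finset.sum_range_succ',
    add_comm (∑ b ∈ Finset.range L, _)]
  have h0 : (if a = 0 then top e d 0 % 2 = 1 else 0 < d (a * L)) ↔
      (if a = 0 then top e d 0 % 2 else gammaBit (d (a * L))) = 1 := by
    unfold gammaBit
    split_ifs <;> simp_all
  have h1 : ∀ m : ℕ, m ≤ 1 → ∀ x : R, (if m = 1 then x else 0) = m * x := by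
    intro m hm x
    interval_cases m <;> simp
  congr 1
  · congr 1
    · refine (if_congr (by rw [if_pos rfl]; exact h0) rfl rfl).trans (h1 _ ?_ _)
      unfold gammaBit; split_ifs <;> omega
    · refine Finset.sum_congr rfl fun b hb => ?_
      rw [Finset.mem_range] at hb
      refine (if_congr (Q := a * L + b ∈ e) ?_ rfl rfl).trans (by split_ifs <;> simp)
      rw [if_neg (Nat.succ_ne_zero b), if_neg (show ¬ b + 1 = L + 1 by omega), Nat.add_sub_cancel]
  · refine (if_congr (by rw [if_neg (Nat.succ_ne_zero L), if_pos rfl]) rfl rfl).trans (h1 _ ?_ _)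
    unfold betaBit; split_ifs <;> omega

/-- Additive statistics of walls are sums over the layers. -/
theorem sum_levels_eq_sum_layers (hn : 4 ≤ n) {R : Type*} [CommRing R] (f u v : ℕ → R)
    (c : ℕ → ℕ → R)
    (hf : ∀ a, ∀ b < 2 * n - 4, f (a * (2 * n - 4) + b) =
      (if a * (2 * n - 4) + b ∈ e then 1 else 0) * c a (b + 1) +
      ((if b = 0 then (if a = 0 then 0 else gammaBit (d (a * (2 * n - 4))) * c a 0 +
        betaBit (d (a * (2 * n - 4))) * c (a - 1) (2 * n - 3) +
        bosonPart (d (a * (2 * n - 4))) * u a) else 0) +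
      (if b = n - 2 then (d (a * (2 * n - 4) + (n - 2))).natAbs * v a else 0))) (A : ℕ) :
    (top e d 0 % 2 : ℕ) * c 0 0 + ∑ y ∈ Finset.range ((A + 1) * (2 * n - 4)), f y +
      betaBit (d ((A + 1) * (2 * n - 4))) * c A (2 * n - 3) +
      bosonPart (d ((A + 1) * (2 * n - 4))) * u (A + 1) =
    ∑ a ∈ Finset.range (A + 1), (∑ t ∈ layerSet n e d a, c a t +
      (d (a * (2 * n - 4) + (n - 2))).natAbs * v a +
      bosonPart (d ((a + 1) * (2 * n - 4))) * u (a + 1)) := by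
  have hsum : ∀ a, ∑ b ∈ Finset.range (2 * n - 4), f (a * (2 * n - 4) + b) =
      ∑ b ∈ Finset.range (2 * n - 4), (if a * (2 * n - 4) + b ∈ e then 1 else 0) * c a (b + 1) +
      ((if a = 0 then 0 else gammaBit (d (a * (2 * n - 4))) * c a 0 +
        betaBit (d (a * (2 * n - 4))) * c (a - 1) (2 * n - 3) +
        bosonPart (d (a * (2 * n - 4))) * u a) +
      (d (a * (2 * n - 4) + (n - 2))).natAbs * v a) := by
    intro a
    rw [Finset.sum_congr rfl fun b hb => hf a b (Finset.mem_range.1 hb), Finset.sum_add_distrib,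
      Finset.sum_add_distrib, Finset.sum_ite_eq', Finset.sum_ite_eq',
      if_pos (Finset.mem_range.2 (by omega)), if_pos (Finset.mem_range.2 (by omega))]
  induction A with
  | zero =>
    have h0 := hsum 0
    simp only [zero_mul, zero_add, if_true] at h0
    simp only [zero_add, one_mul, Finset.sum_range_one, sum_layerSet hn, if_true, h0, zero_mul]
    ring
  | succ A ih =>
    rw [Finset.sum_range_succ _ (A + 1), ← ih, show (A + 1 + 1) * (2 * n - 4) =
      (A + 1) * (2 * n - 4) + (2 * n - 4) by ring, Finset.sum_range_add, hsum, sum_layerSet hn,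
      if_neg (Nat.succ_ne_zero A), if_neg (Nat.succ_ne_zero A), Nat.add_sub_cancel,
      show (A + 1 + 1) * (2 * n - 4) = (A + 1) * (2 * n - 4) + (2 * n - 4) by ring]
    ring

theorem eq_zero_of_layer (hn : 4 ≤ n) (hd : HalfSupported n d) {a b : ℕ} (hb : b < 2 * n - 4)
    (h0 : b ≠ 0) (h1 : b ≠ n - 2) : d (a * (2 * n - 4) + b) = 0 := by
  refine hd.eq_zero ?_
  rw [dvd_iff_mod_period hn, Nat.mul_add_mod', Nat.mod_eq_of_lt hb]
  tauto

theorem layer_div {a b : ℕ} (hb : b < 2 * n - 4) :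
    (a * (2 * n - 4) + b) / (2 * n - 4) = a := by
  rw [mul_comm, Nat.mul_add_div (by omega), Nat.div_eq_of_lt hb, add_zero]

/-- The weight of a layer. -/
def layerWeight (a : ℕ) (x : Finset ℕ × ℤ × ℕ) : ℕ :=
  (2 * a + 1) * (x.1.card + x.2.1.natAbs) + 4 * (a + 1) * x.2.2

/-- The `a`-th layer of a wall. -/
def layerOf (n : ℕ) (e : Finset ℕ) (d : ℕ →₀ ℤ) (a : ℕ) : Finset ℕ × ℤ × ℕ :=
  (layerSet n e d a, d (a * (2 * n - 4) + (n - 2)), bosonPart (d ((a + 1) * (2 * n - 4))))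

/-- At level `a L`, `a ≥ 1`, the contribution `2 a |D| + γ - β` with `|D| = 2 j + β + γ` equals `4 a
j + (2 a - 1) β + (2 a + 1) γ`. Hence `β` has the weight of a fermion of layer `a - 1` and `γ` that
of one of layer `a`. -/
theorem two_mul_wt_zero_eq_sum_layers (hn : 4 ≤ n) (hd : HalfSupported n d) {A : ℕ}
    (hA : ∀ y, (A + 1) * (2 * n - 4) ≤ y → y ∉ e ∧ d y = 0) :
    2 * wt n (wallOf n e d) 0 = ∑ a ∈ Finset.range (A + 1), layerWeight a (layerOf n e d a) := by
  have h1 := sum_levels_eq_sum_layers (e := e) (d := d) hn (R := ℤ)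
    (fun y => (if y ∈ e then 1 else 0) * (2 * (y / (2 * n - 4) : ℕ) + 1) + halfWeight n y (d y))
    (fun a => 4 * a) (fun a => 2 * a + 1) (fun a _ => 2 * a + 1) (by
      intro a b hb
      simp only [layer_div hb]
      congr 1
      rw [halfWeight, layer_div hb, Nat.mul_add_mod', Nat.mod_eq_of_lt hb]
      by_cases h0 : b = 0
      · subst h0
        rw [if_pos rfl, if_pos rfl, if_neg (show ¬ 0 = n - 2 by omega)]
        by_cases ha : a = 0
        · subst ha
          simp [hd.zero, gammaBit, betaBit]
        · rw [if_neg ha, add_zero, natAbs_eq_bits, Nat.cast_pred (Nat.pos_of_ne_zero ha)]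
          push_cast
          ring
      · rw [if_neg h0, if_neg h0]
        by_cases h2 : b = n - 2
        · rw [if_pos h2, h2]; ring
        · rw [if_neg h2, eq_zero_of_layer hn hd hb h0 h2]; simp) A
  have h2 := two_mul_wt_zero hn hd hA
  rw [(hA _ le_rfl).2] at h1
  zify
  rw [h2]
  simp only [Nat.cast_zero, mul_zero, zero_add, mul_one] at h1
  simp only [betaBit, bosonPart, gammaBit, ne_eq, not_true_eq_false, false_and, if_false,
    lt_irrefl, Int.natAbs_zero, Nat.sub_zero, Nat.zero_div, Nat.cast_zero, zero_mul, add_zero] at h1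
  rw [h1]
  refine Finset.sum_congr rfl fun a _ => ?_
  simp only [layerWeight, layerOf, bosonPart, betaBit, gammaBit, Finset.sum_const, nsmul_eq_mul]
  push_cast
  ring

/-- The exponents of the roots of unity by which the fermionic parts of a layer are counted. -/
def rootExp (n t : ℕ) : ℕ := n + t + if t ≤ n - 2 then 0 else 1

/-- Modulo `2 n - 1` the period `2 n - 4` is `-3`; raising a full column by one period adds `2 n -
2` white blocks and on average one to the `0`-weight, in total `0`. So contributions do not depend
on the layer. -/
theorem whites_add_wt_zero_modEq (hn : 4 ≤ n) (hd : HalfSupported n d) {A : ℕ}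
    (hA : ∀ y, (A + 1) * (2 * n - 4) ≤ y → y ∉ e ∧ d y = 0) :
    whites (wallOf n e d) + wt n (wallOf n e d) 0 ≡
      ∑ a ∈ Finset.range (A + 1), ∑ t ∈ layerSet n e d a, rootExp n t [MOD 2 * n - 1] := by
  rw [← ZMod.natCast_eq_natCast_iff]
  have hq : (2 * n : ZMod (2 * n - 1)) = 1 := by
    have h := ZMod.natCast_self (2 * n - 1)
    rw [Nat.cast_sub (by omega)] at h
    push_cast at h
    linear_combination h
  have hL : ((2 * n - 4 : ℕ) : ZMod (2 * n - 1)) = -3 := by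
    rw [Nat.cast_sub (by omega)]
    push_cast
    linear_combination hq
  -- `n` is the inverse of `2`, so the formula for twice the `0`-weight can be used.
  have hwt : (wt n (wallOf n e d) 0 : ZMod (2 * n - 1)) =
      n * (2 * wt n (wallOf n e d) 0 : ℤ) := by
    push_cast
    linear_combination (-(wt n (wallOf n e d) 0 : ZMod (2 * n - 1))) * hq
  have hdivh : ∀ a b, (a * (2 * n - 4) + b) / (n - 2) = 2 * a + b / (n - 2) := by
    intro a b
    rw [show a * (2 * n - 4) + b = (n - 2) * (2 * a) + b by
      rw [show 2 * n - 4 = 2 * (n - 2) by omega]; ring, Nat.mul_add_div (by omega)]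
  have hc : ∀ b < 2 * n - 4, b / (n - 2) = if b + 1 ≤ n - 2 then 0 else 1 := by
    intro b hb
    split_ifs with h
    · exact Nat.div_eq_of_lt (by omega)
    · refine Nat.div_eq_of_lt_le ?_ ?_ <;> omega
  have hbits : ∀ D : ℤ, ((D.natAbs : ℕ) : ZMod (2 * n - 1)) =
      2 * bosonPart D + betaBit D + gammaBit D := by
    intro D
    rw [natAbs_eq_bits]
    push_cast
    rfl
  have h1 := sum_levels_eq_sum_layers (e := e) (d := d) hn (R := ZMod (2 * n - 1))
    (fun y => ((if y ∈ e then 1 else 0) * (y + y / (n - 2) + 1) +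
      (d y).natAbs * (y + y / (n - 2)) : ℕ) +
      n * ((if y ∈ e then 1 else 0) * (2 * (y / (2 * n - 4) : ℕ) + 1) + halfWeight n y (d y) : ℤ))
    -- A pair of half-blocks counted by the bosonic part at level `a L` contributes `2 a (2 n - 1)`,
    -- and a half-block of label `n - 1` or `n` in layer `a` contributes half of `(2 a + 1) (2 n -
    -- 1)`; both vanish in `ZMod (2 * n - 1)`.
    (fun a => 0) (fun a => 0) (fun _ t => rootExp n t) (by
      intro a b hb
      rw [halfWeight, layer_div hb, Nat.mul_add_mod', Nat.mod_eq_of_lt hb, hdivh, hc b hb]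
      by_cases h0 : b = 0
      · subst h0
        rw [if_pos rfl, if_pos rfl, if_neg (show ¬ 0 = n - 2 by omega),
          if_pos (show 0 + 1 ≤ n - 2 by omega)]
        simp only [add_zero]
        by_cases ha : a = 0
        · subst ha
          simp only [zero_mul, zero_add, hd.zero, if_true, rootExp, Int.natAbs_zero]
          rw [if_pos (show 1 ≤ n - 2 by omega)]
          simp only [gammaBit, betaBit, lt_irrefl, if_false, ne_eq, not_true_eq_false, false_and]
          push_cast
          split_ifs <;> simp [add_comm]
        · rw [if_neg ha]
          simp only [rootExp]
          rw [if_pos (show 0 + 1 ≤ n - 2 by omega), if_pos (show 0 ≤ n - 2 by omega),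
            if_neg (show ¬ 2 * n - 3 ≤ n - 2 by omega)]
          have h3 : ((2 * n - 3 : ℕ) : ZMod (2 * n - 1)) = -2 := by
            rw [Nat.cast_sub (by omega)]
            push_cast
            linear_combination hq
          have h4 := hbits (d (a * (2 * n - 4)))
          generalize (d (a * (2 * n - 4))).natAbs = m at *
          push_cast
          simp only [h3, hL, h4]
          set ε : ZMod (2 * n - 1) := if a * (2 * n - 4) ∈ e then 1 else 0
          linear_combination (ε * a +
            (2 * bosonPart (d (a * (2 * n - 4))) + betaBit (d (a * (2 * n - 4))) +
              gammaBit (d (a * (2 * n - 4)))) * a - betaBit (d (a * (2 * n - 4)))) * hq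
      · rw [if_neg h0, if_neg h0]
        by_cases h2 : b = n - 2
        · rw [if_pos h2, ← h2]
          have h3 : ¬ b + 1 ≤ n - 2 := by omega
          have h4 : (b : ZMod (2 * n - 1)) = n - 2 := by
            rw [h2, Nat.cast_sub (by omega)]; norm_num
          simp only [rootExp]
          rw [if_neg h3, if_neg (show ¬ b + 1 ≤ b by omega)]
          generalize (d (a * (2 * n - 4) + b)).natAbs = m
          push_cast
          simp only [hL, h4]
          set ε : ZMod (2 * n - 1) := if a * (2 * n - 4) + b ∈ e then 1 else 0
          linear_combination (ε * a + m * (a + 1)) * hq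
        · rw [if_neg h2, eq_zero_of_layer hn hd hb h0 h2]
          simp only [rootExp, Int.natAbs_zero]
          set κ : ℕ := if b + 1 ≤ n - 2 then 0 else 1
          push_cast
          simp only [hL]
          set ε : ZMod (2 * n - 1) := if a * (2 * n - 4) + b ∈ e then 1 else 0
          linear_combination (ε * a) * hq) A
  have h2 := two_mul_wt_zero hn hd hA
  rw [(hA _ le_rfl).2] at h1
  rw [Nat.cast_add, hwt, h2, whites_wallOf_eq hd hA]
  have hr : rootExp n 0 = n := by simp [rootExp]
  have hb : betaBit 0 = 0 := by simp [betaBit]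
  simp only [mul_zero, add_zero, hr, hb, Nat.cast_zero, zero_mul] at h1
  rw [Finset.sum_add_distrib, ← Finset.mul_sum] at h1
  generalize top e d 0 % 2 = τ at h1 ⊢
  push_cast at h1 ⊢
  linear_combination h1

end

/-! ### Walls correspond to sequences of layers -/

section

variable {n : ℕ} {e e' : Finset ℕ} {d d' : ℕ →₀ ℤ}

theorem layerSet_subset (n : ℕ) (e : Finset ℕ) (d : ℕ →₀ ℤ) (a : ℕ) :
    layerSet n e d a ⊆ Finset.range (2 * n - 2) := Finset.filter_subset _ _

theorem zero_mem_layerSet (hn : 4 ≤ n) {a : ℕ} : 0 ∈ layerSet n e d a ↔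
    if a = 0 then top e d 0 % 2 = 1 else 0 < d (a * (2 * n - 4)) := by
  rw [layerSet, Finset.mem_filter, Finset.mem_range, if_pos rfl]
  exact and_iff_right (by omega)

theorem last_mem_layerSet (hn : 4 ≤ n) {a : ℕ} : 2 * n - 3 ∈ layerSet n e d a ↔
    betaBit (d ((a + 1) * (2 * n - 4))) = 1 := by
  rw [layerSet, Finset.mem_filter, Finset.mem_range, if_neg (by omega), if_pos rfl]
  exact and_iff_right (by omega)

theorem succ_mem_layerSet {a b : ℕ} (hb : b < 2 * n - 4) :
    b + 1 ∈ layerSet n e d a ↔ a * (2 * n - 4) + b ∈ e := by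
  rw [layerSet, Finset.mem_filter, Finset.mem_range, if_neg (by omega), if_neg (by omega),
    Nat.add_sub_cancel]
  exact and_iff_right (by omega)

theorem betaBit_eq_one {D : ℤ} : betaBit D = 1 ↔ D ≠ 0 ∧ (0 < D ↔ D % 2 = 0) := by
  simp [betaBit]

theorem gammaBit_eq_one {D : ℤ} : gammaBit D = 1 ↔ 0 < D := by
  simp [gammaBit]

theorem betaBit_le (D : ℤ) : betaBit D ≤ 1 := by
  unfold betaBit; split_ifs <;> omega

theorem gammaBit_le (D : ℤ) : gammaBit D ≤ 1 := by
  unfold gammaBit; split_ifs <;> omega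

/-- The local form of the condition that a wall is `0`-generated and distinguished. -/
def IsAllowed (n : ℕ) (x : Finset ℕ × ℤ × ℕ) : Prop :=
  (∀ t ∈ x.1, t + 1 < 2 * n - 2 → t + 1 ∈ x.1) ∧ (n - 2 ∈ x.1 → x.2.1 = 0) ∧
    (x.2.1 ≠ 0 → n - 1 ∈ x.1 ∧ n - 1 < x.2.1.natAbs)

/-- The conditions form a chain `t ∈ F → t + 1 ∈ F`. At a positive level `(a + 1) L` it is cut: `y -
1 ∈ e` forces `β = 1`, the end of layer `a`, and `γ = 1` forces `y ∈ e`, the start of layer `a + 1`.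
At level `0` the parity of the number of columns plays the role of `γ`. -/
theorem isDistinguished_iff_layers (hn : 4 ≤ n) (hd : HalfSupported n d) :
    IsDistinguished n (wallOf n e d) ↔ ∀ a, IsAllowed n (layerOf n e d a) := by
  rw [isDistinguished_wallOf_iff hn hd]
  have hmod : ∀ a b, b < 2 * n - 4 → (a * (2 * n - 4) + b) % (2 * n - 4) = b := fun a b hb => by
    rw [Nat.mul_add_mod', Nat.mod_eq_of_lt hb]
  constructor
  · rintro ⟨H1, H2, H3, H4⟩ a
    refine ⟨?_, ?_, ?_⟩
    · intro t ht htn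
      change t ∈ layerSet n e d a at ht
      change t + 1 ∈ layerSet n e d a
      rcases Nat.eq_zero_or_pos t with rfl | ht0
      · rw [zero_mem_layerSet hn] at ht
        rw [succ_mem_layerSet (by omega), add_zero]
        split_ifs at ht with ha
        · subst ha
          by_contra h
          rw [zero_mul] at h
          have := H4 h
          omega
        · refine (H3 _ ?_ (Nat.mul_mod_left _ _)).2 ht
          exact Nat.mul_ne_zero ha (by omega)
      · obtain ⟨b, rfl⟩ : ∃ b, t = b + 1 := ⟨t - 1, by omega⟩
        rw [succ_mem_layerSet (by omega)] at ht
        by_cases hb : b + 1 = 2 * n - 4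
        · rw [show b + 1 + 1 = 2 * n - 3 by omega, last_mem_layerSet hn, betaBit_eq_one]
          have h1 : (a + 1) * (2 * n - 4) = a * (2 * n - 4) + b + 1 := by rw [← hb]; ring
          rw [h1]
          refine (H3 _ (Nat.succ_ne_zero _) ?_).1 ht
          rw [Nat.succ_eq_add_one, ← h1]
          exact Nat.mul_mod_left _ _
        · rw [succ_mem_layerSet (by omega)]
          have hm := hmod a (b + 1) (by omega)
          by_cases hb' : b + 1 = n - 2
          · exact ((H1 (a * (2 * n - 4) + (b + 1)) (by rw [hm, hb'])).2 ht).2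
          · refine H2 (a * (2 * n - 4) + (b + 1)) ?_ ht
            rw [dvd_iff_mod_period hn, hm]
            omega
    · intro ht
      change n - 2 ∈ layerSet n e d a at ht
      rw [show n - 2 = n - 3 + 1 by omega, succ_mem_layerSet (by omega)] at ht
      refine ((H1 (a * (2 * n - 4) + (n - 2)) (hmod _ _ (by omega))).2 ?_).1
      rwa [show a * (2 * n - 4) + (n - 2) - 1 = a * (2 * n - 4) + (n - 3) by omega]
    · intro h0
      change n - 1 ∈ layerSet n e d a ∧ _
      rw [show n - 1 = n - 2 + 1 by omega, succ_mem_layerSet (by omega),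
        show n - 2 + 1 = n - 1 by omega]
      exact (H1 (a * (2 * n - 4) + (n - 2)) (hmod _ _ (by omega))).1 h0
  · intro H
    have hstep : ∀ a b, b + 1 < 2 * n - 4 → a * (2 * n - 4) + b ∈ e →
        a * (2 * n - 4) + (b + 1) ∈ e := by
      intro a b hb h
      rw [← succ_mem_layerSet (d := d) (by omega)] at h ⊢
      exact (H a).1 _ h (by omega)
    refine ⟨fun y hy => ?_, fun y hy hye => ?_, fun y hy0 hy => ?_, fun h0 => ?_⟩
    · have hyd := Nat.div_add_mod' y (2 * n - 4)
      rw [hy] at hyd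
      have h2 := (H (y / (2 * n - 4))).2
      simp only [layerOf] at h2
      rw [hyd] at h2
      refine ⟨fun h0 => ?_, fun hye => ?_⟩
      · have h3 := h2.2 h0
        rw [show n - 1 = n - 2 + 1 by omega, succ_mem_layerSet (by omega), hyd] at h3
        exact ⟨h3.1, by omega⟩
      · rw [show y - 1 = y / (2 * n - 4) * (2 * n - 4) + (n - 3) by omega] at hye
        refine ⟨h2.1 ?_, ?_⟩
        · rw [show n - 2 = n - 3 + 1 by omega, succ_mem_layerSet (by omega)]
          exact hye
        · have := hstep _ _ (by omega) hye
          rwa [show n - 3 + 1 = n - 2 by omega, hyd] at this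
    · have hyd := Nat.div_add_mod' y (2 * n - 4)
      rw [dvd_iff_mod_period hn, not_or] at hy
      have hlt : y % (2 * n - 4) < 2 * n - 4 := Nat.mod_lt _ (by omega)
      obtain ⟨b, hb⟩ : ∃ b, y % (2 * n - 4) = b + 1 := ⟨y % (2 * n - 4) - 1, by omega⟩
      rw [hb] at hyd hlt
      rw [show y - 1 = y / (2 * n - 4) * (2 * n - 4) + b by omega] at hye
      have := hstep _ _ hlt hye
      rwa [hyd] at this
    · obtain ⟨a, rfl⟩ : ∃ a, y = (a + 1) * (2 * n - 4) := by
        obtain ⟨c, rfl⟩ := Nat.dvd_of_mod_eq_zero hy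
        obtain ⟨a, rfl⟩ : ∃ a, c = a + 1 :=
          ⟨c - 1, by have : c ≠ 0 := by rintro rfl; exact hy0 (mul_zero _)
                     omega⟩
        exact ⟨a, mul_comm _ _⟩
      refine ⟨fun hye => ?_, fun hpos => ?_⟩
      · rw [← betaBit_eq_one, ← last_mem_layerSet (e := e) hn]
        rw [show (a + 1) * (2 * n - 4) - 1 = a * (2 * n - 4) + (2 * n - 5) by
          rw [Nat.succ_mul]; omega, ← succ_mem_layerSet (d := d) (by omega)] at hye
        have := (H a).1 _ hye (by omega)
        rwa [show 2 * n - 5 + 1 + 1 = 2 * n - 3 by omega] at this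
      · have h1 : 0 ∈ layerSet n e d (a + 1) := (zero_mem_layerSet hn).2 hpos
        have := (H (a + 1)).1 _ h1 (by omega)
        exact (succ_mem_layerSet (b := 0) (by omega)).1 this
    · by_contra h
      have h1 : 0 ∈ layerSet n e d 0 := by
        rw [zero_mem_layerSet hn, if_pos rfl]
        omega
      have := (succ_mem_layerSet (b := 0) (by omega)).1 ((H 0).1 _ h1 (by omega))
      rw [zero_mul] at this
      exact h0 this

/-- A wall of `0`-weight `k` ends below the layer `k + 1`. -/
theorem bound_of_wt_zero (hn : 4 ≤ n) (hd : HalfSupported n d) {y : ℕ}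
    (hy : (wt n (wallOf n e d) 0 + 1) * (2 * n - 4) ≤ y) : y ∉ e ∧ d y = 0 := by
  obtain ⟨H, hH⟩ := exists_bound e d
  have hH' : ∀ y, (H + 1) * (2 * n - 4) ≤ y → y ∉ e ∧ d y = 0 := by
    intro y hy
    refine hH y ?_
    nlinarith [show 1 ≤ 2 * n - 4 by omega]
  have hsum := two_mul_wt_zero_eq_sum_layers hn hd hH'
  have hle : ∀ a, a ≤ H → layerWeight a (layerOf n e d a) ≤ 2 * wt n (wallOf n e d) 0 := by
    intro a ha
    rw [hsum]
    exact Finset.single_le_sum (f := fun a => layerWeight a (layerOf n e d a))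
      (fun _ _ => Nat.zero_le _) (Finset.mem_range.2 (by omega))
  generalize wt n (wallOf n e d) 0 = k at *
  -- One element of `F` in layer `a` already costs `2 a + 1`, which is at most `2 k`.
  have hmem : ∀ a t, a ≤ H → t ∈ layerSet n e d a → a < k := by
    intro a t ha ht
    have h1 := hle a ha
    have h2 := Finset.card_pos.2 ⟨t, ht⟩
    simp only [layerWeight, layerOf] at h1
    by_contra h
    nlinarith [Nat.zero_le (d (a * (2 * n - 4) + (n - 2))).natAbs,
      Nat.zero_le (4 * (a + 1) * bosonPart (d ((a + 1) * (2 * n - 4))))]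
  have hyd := Nat.div_add_mod' y (2 * n - 4)
  have hlt : y % (2 * n - 4) < 2 * n - 4 := Nat.mod_lt _ (by omega)
  have hky : k + 1 ≤ y / (2 * n - 4) := (Nat.le_div_iff_mul_le (by omega)).2 hy
  have hyH : y < H → y / (2 * n - 4) ≤ H := fun h => (Nat.div_le_self _ _).trans h.le
  generalize y / (2 * n - 4) = a at *
  generalize y % (2 * n - 4) = b at *
  constructor
  · intro hye
    have h1 : a ≤ H := hyH (by by_contra h; exact (hH y (not_lt.1 h)).1 hye)
    rw [← hyd, ← succ_mem_layerSet (d := d) hlt] at hye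
    have := hmem a _ h1 hye
    omega
  · by_contra h0
    have h1 : a ≤ H := hyH (by by_contra h; exact h0 (hH y (not_lt.1 h)).2)
    rcases ((dvd_iff_mod_period hn y).1 (hd y h0).2) with h2 | h2
    · rw [← hyd, Nat.mul_add_mod', Nat.mod_eq_of_lt hlt] at h2
      subst h2
      rw [add_zero] at hyd
      subst hyd
      have h3 := natAbs_eq_bits (d (a * (2 * n - 4)))
      obtain ⟨c, rfl⟩ : ∃ c, a = c + 1 := ⟨a - 1, by omega⟩
      have h4 : ¬ 0 < d ((c + 1) * (2 * n - 4)) := by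
        intro h
        have h5 : 0 ∈ layerSet n e d (c + 1) := (zero_mem_layerSet hn).2 h
        have := hmem _ _ h1 h5
        omega
      have h5 : ¬ betaBit (d ((c + 1) * (2 * n - 4))) = 1 := by
        intro h
        have := hmem c _ (by omega) ((last_mem_layerSet hn).2 h)
        omega
      have h6 := hle c (by omega)
      simp only [layerWeight, layerOf] at h6
      have h7 := betaBit_le (d ((c + 1) * (2 * n - 4)))
      have h8 : gammaBit (d ((c + 1) * (2 * n - 4))) = 0 := if_neg h4
      have h9 : 1 ≤ bosonPart (d ((c + 1) * (2 * n - 4))) := by omega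
      have h10 := Nat.mul_le_mul_left (4 * (c + 1)) h9
      omega
    · rw [← hyd, Nat.mul_add_mod', Nat.mod_eq_of_lt hlt] at h2
      subst h2
      have h6 := hle a h1
      simp only [layerWeight, layerOf] at h6
      rw [hyd] at h6
      have h9 : 1 ≤ (layerSet n e d a).card + (d y).natAbs := by omega
      have h10 := Nat.mul_le_mul_left (2 * a + 1) h9
      omega

/-- At a level `(c + 1) L` the value of `d` is put together from `β` and `j` in layer `c` and `γ` in
layer `c + 1`. The bit `0` of layer `0` is not needed. -/
theorem eq_of_layerOf_eq (hn : 4 ≤ n) (hd : HalfSupported n d) (hd' : HalfSupported n d') {A : ℕ}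
    (hA : ∀ y, (A + 1) * (2 * n - 4) ≤ y → y ∉ e ∧ d y = 0)
    (hA' : ∀ y, (A + 1) * (2 * n - 4) ≤ y → y ∉ e' ∧ d' y = 0)
    (h : ∀ a < A + 1, layerOf n e d a = layerOf n e' d' a) : e = e' ∧ d = d' := by
  have key : ∀ y, (y ∈ e ↔ y ∈ e') ∧ d y = d' y := by
    intro y
    by_cases hy : (A + 1) * (2 * n - 4) ≤ y
    · have h1 := hA y hy
      have h2 := hA' y hy
      exact ⟨iff_of_false h1.1 h2.1, by rw [h1.2, h2.2]⟩
    have hyd := Nat.div_add_mod' y (2 * n - 4)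
    have hlt : y % (2 * n - 4) < 2 * n - 4 := Nat.mod_lt _ (by omega)
    have hky : y / (2 * n - 4) < A + 1 := (Nat.div_lt_iff_lt_mul (by omega)).2 (not_le.1 hy)
    have hdvd := dvd_iff_mod_period hn y
    generalize y / (2 * n - 4) = a at *
    generalize y % (2 * n - 4) = b at *
    have hF : layerSet n e d a = layerSet n e' d' a := congrArg Prod.fst (h a hky)
    constructor
    · rw [← hyd, ← succ_mem_layerSet (d := d) hlt, ← succ_mem_layerSet (d := d') hlt, hF]
    · by_cases hdv : (n - 2) ∣ y
      swap
      · rw [hd.eq_zero hdv, hd'.eq_zero hdv]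
      rcases hdvd.1 hdv with rfl | rfl
      · rw [add_zero] at hyd
        subst hyd
        rcases Nat.eq_zero_or_pos a with rfl | ha
        · rw [zero_mul, hd.zero, hd'.zero]
        obtain ⟨c, rfl⟩ : ∃ c, a = c + 1 := ⟨a - 1, by omega⟩
        have hF' : layerSet n e d c = layerSet n e' d' c :=
          congrArg Prod.fst (h c (by omega))
        have h1 := zero_mem_layerSet (e := e) (d := d) hn (a := c + 1)
        have h2 := zero_mem_layerSet (e := e') (d := d') hn (a := c + 1)
        have h3 := last_mem_layerSet (e := e) (d := d) hn (a := c)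
        have h4 := last_mem_layerSet (e := e') (d := d') hn (a := c)
        rw [if_neg (Nat.succ_ne_zero c), ← gammaBit_eq_one] at h1 h2
        rw [hF, h2] at h1
        rw [hF', h4] at h3
        have := betaBit_le (d ((c + 1) * (2 * n - 4)))
        have := betaBit_le (d' ((c + 1) * (2 * n - 4)))
        have := gammaBit_le (d ((c + 1) * (2 * n - 4)))
        have := gammaBit_le (d' ((c + 1) * (2 * n - 4)))
        refine ext_bits (by omega) (by omega) ?_
        exact congrArg (fun x => x.2.2) (h c (by omega))
      · rw [← hyd]
        exact congrArg (fun x => x.2.1) (h a hky)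
  exact ⟨Finset.ext fun y => (key y).1, Finsupp.ext fun y => (key y).2⟩

end

section

variable {n : ℕ}

/-- Every sequence of layers of even total weight comes from a wall. -/
theorem exists_of_layers (hn : 4 ≤ n) {k : ℕ} (g : ℕ → Finset ℕ × ℤ × ℕ)
    (hg : ∀ a, (g a).1 ⊆ Finset.range (2 * n - 2))
    (hk : ∑ a ∈ Finset.range (k + 1), layerWeight a (g a) = 2 * k) :
    ∃ (e : Finset ℕ) (d : ℕ →₀ ℤ), HalfSupported n d ∧ wt n (wallOf n e d) 0 = k ∧
      ∀ a < k + 1, layerOf n e d a = g a := by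
  classical
  have hL : 0 < 2 * n - 4 := by omega
  -- The last layer must have no fermionic or bosonic part there, since these cost at least `2 k +
  -- 1` and `4 (k + 1)`. So `d` may be set to `0` from level `(k + 1) L` on.
  have hgk : (g k).1 = ∅ ∧ (g k).2.2 = 0 := by
    have h1 : layerWeight k (g k) ≤ 2 * k := by
      rw [← hk]
      exact Finset.single_le_sum (f := fun a => layerWeight a (g a))
        (fun _ _ => Nat.zero_le _) (Finset.mem_range.2 (by omega))
    unfold layerWeight at h1
    constructor
    · rw [← Finset.card_eq_zero]
      by_contra h
      have h9 : 1 ≤ (g k).1.card + (g k).2.1.natAbs := by omega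
      have h10 := Nat.mul_le_mul_left (2 * k + 1) h9
      omega
    · by_contra h
      have h9 : 1 ≤ (g k).2.2 := by omega
      have h10 := Nat.mul_le_mul_left (4 * (k + 1)) h9
      omega
  choose D hDb hDc hDj using exists_bits
  let e : Finset ℕ := (Finset.range ((k + 1) * (2 * n - 4))).filter fun y =>
    y % (2 * n - 4) + 1 ∈ (g (y / (2 * n - 4))).1
  let f : ℕ → ℤ := fun y =>
    if y = 0 ∨ (k + 1) * (2 * n - 4) ≤ y then 0
    else if y % (2 * n - 4) = 0 then
      D (decide (2 * n - 3 ∈ (g (y / (2 * n - 4) - 1)).1)) (decide (0 ∈ (g (y / (2 * n - 4))).1))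
        (g (y / (2 * n - 4) - 1)).2.2
    else if y % (2 * n - 4) = n - 2 then (g (y / (2 * n - 4))).2.1 else 0
  let d : ℕ →₀ ℤ := Finsupp.onFinset (Finset.range ((k + 1) * (2 * n - 4))) f (by
    intro y hy
    rw [Finset.mem_range]
    by_contra h
    exact hy (if_pos (Or.inr (not_lt.1 h))))
  have hdf : ∀ y, d y = f y := fun y => rfl
  have hd : HalfSupported n d := by
    intro y hy
    rw [hdf] at hy
    constructor
    · rintro rfl
      exact hy (if_pos (Or.inl rfl))
    · rw [dvd_iff_mod_period hn]
      by_contra h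
      rw [not_or] at h
      apply hy
      simp only [f]
      rw [if_neg h.1, if_neg h.2, ite_self]
  have hbound : ∀ y, (k + 1) * (2 * n - 4) ≤ y → y ∉ e ∧ d y = 0 := by
    intro y hy
    refine ⟨?_, if_pos (Or.inr hy)⟩
    simp only [e, Finset.mem_filter, Finset.mem_range, not_and]
    omega
  have hlt : ∀ a b, a < k + 1 → b < 2 * n - 4 → a * (2 * n - 4) + b < (k + 1) * (2 * n - 4) := by
    intro a b ha hb
    have := Nat.mul_le_mul_right (2 * n - 4) (show a + 1 ≤ k + 1 from ha)
    rw [Nat.succ_mul] at this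
    omega
  have hmod : ∀ a b, b < 2 * n - 4 → (a * (2 * n - 4) + b) % (2 * n - 4) = b := fun a b hb => by
    rw [Nat.mul_add_mod', Nat.mod_eq_of_lt hb]
  have he : ∀ a b, a < k + 1 → b < 2 * n - 4 →
      (a * (2 * n - 4) + b ∈ e ↔ b + 1 ∈ (g a).1) := by
    intro a b ha hb
    simp only [e, Finset.mem_filter, Finset.mem_range]
    rw [hmod a b hb, layer_div hb]
    exact and_iff_right (hlt a b ha hb)
  have hd0 : ∀ a, a + 1 < k + 1 → d ((a + 1) * (2 * n - 4)) =
      D (decide (2 * n - 3 ∈ (g a).1)) (decide (0 ∈ (g (a + 1)).1)) (g a).2.2 := by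
    intro a ha
    have h1 := hlt (a + 1) 0 ha hL
    have h2 : (a + 1) * (2 * n - 4) ≠ 0 := Nat.mul_ne_zero (Nat.succ_ne_zero a) hL.ne'
    rw [hdf]
    simp only [f]
    rw [if_neg (by omega), if_pos (Nat.mul_mod_left _ _), Nat.mul_div_cancel _ hL,
      Nat.add_sub_cancel]
  have hdh : ∀ a, a < k + 1 → d (a * (2 * n - 4) + (n - 2)) = (g a).2.1 := by
    intro a ha
    have h1 := hlt a (n - 2) ha (by omega)
    rw [hdf]
    simp only [f]
    rw [if_neg (by omega), hmod _ _ (by omega), if_neg (by omega), if_pos rfl,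
      layer_div (by omega)]
  have hdlast : ∀ a, a < k + 1 → (betaBit (d ((a + 1) * (2 * n - 4))) = 1 ↔
      2 * n - 3 ∈ (g a).1) ∧ bosonPart (d ((a + 1) * (2 * n - 4))) = (g a).2.2 := by
    intro a ha
    by_cases hak : a + 1 < k + 1
    · rw [hd0 a hak, hDb, hDj]
      by_cases h : 2 * n - 3 ∈ (g a).1 <;> simp [h]
    · obtain rfl : a = k := by omega
      rw [(hbound _ le_rfl).2, hgk.1, hgk.2]
      simp [betaBit, bosonPart, gammaBit]
  have hset : ∀ a, a < k + 1 → ∀ t, (t = 0 → a ≠ 0) → (t ∈ layerSet n e d a ↔ t ∈ (g a).1) := by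
    intro a ha t hat
    rcases Nat.eq_zero_or_pos t with rfl | ht
    · rw [zero_mem_layerSet hn, if_neg (hat rfl)]
      obtain ⟨c, rfl⟩ : ∃ c, a = c + 1 := ⟨a - 1, by have := hat rfl; omega⟩
      rw [hd0 c ha, ← gammaBit_eq_one, hDc]
      by_cases h : 0 ∈ (g (c + 1)).1 <;> simp [h]
    · obtain ⟨b, rfl⟩ : ∃ b, t = b + 1 := ⟨t - 1, by omega⟩
      by_cases hb : b < 2 * n - 4
      · rw [succ_mem_layerSet hb, he a b ha hb]
      · by_cases hb' : b + 1 = 2 * n - 3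
        · rw [hb', last_mem_layerSet hn]
          exact (hdlast a ha).1
        · refine iff_of_false (fun h => ?_) fun h => ?_
          · have := Finset.mem_range.1 (layerSet_subset n e d a h)
            omega
          · have := Finset.mem_range.1 (hg a h)
            omega
  have hlayer : ∀ a, a < k + 1 → a ≠ 0 → layerOf n e d a = g a := by
    intro a ha ha0
    refine Prod.ext (Finset.ext fun t => hset a ha t fun _ => ha0) (Prod.ext (hdh a ha) ?_)
    exact (hdlast a ha).2
  have hsum := two_mul_wt_zero_eq_sum_layers hn hd hbound
  -- Everything was prescribed except the bit `0` of layer `0`, which the wall itself determines.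
  -- Elements of layer `0` have weight `1`, so evenness of both total weights forces this bit to
  -- agree as well.
  have hdiff : 2 * wt n (wallOf n e d) 0 + (g 0).1.card = 2 * k + (layerSet n e d 0).card := by
    rw [Finset.sum_range_succ'] at hsum hk
    have h1 : ∑ a ∈ Finset.range k, layerWeight (a + 1) (layerOf n e d (a + 1)) =
        ∑ a ∈ Finset.range k, layerWeight (a + 1) (g (a + 1)) :=
      Finset.sum_congr rfl fun a ha => by
        rw [hlayer _ (by have := Finset.mem_range.1 ha; omega) (Nat.succ_ne_zero a)]
    rw [h1] at hsum
    have h2 : layerWeight 0 (layerOf n e d 0) + (g 0).1.card =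
        layerWeight 0 (g 0) + (layerSet n e d 0).card := by
      have h3 := hdh 0 (by omega)
      have h4 := (hdlast 0 (by omega)).2
      simp only [layerWeight, layerOf, h3, h4]
      ring
    omega
  have herase : (layerSet n e d 0).erase 0 = (g 0).1.erase 0 := by
    ext t
    rw [Finset.mem_erase, Finset.mem_erase]
    exact and_congr_right fun ht => hset 0 (by omega) t fun h => absurd h ht
  have hzero : layerSet n e d 0 = (g 0).1 := by
    have h1 := congrArg Finset.card herase
    by_cases ha : 0 ∈ layerSet n e d 0 <;> by_cases hb : 0 ∈ (g 0).1
    · rw [← Finset.insert_erase ha, herase, Finset.insert_erase hb]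
    · rw [Finset.card_erase_of_mem ha, Finset.erase_eq_of_notMem hb] at h1
      have := Finset.card_pos.2 ⟨0, ha⟩
      omega
    · rw [Finset.card_erase_of_mem hb, Finset.erase_eq_of_notMem ha] at h1
      have := Finset.card_pos.2 ⟨0, hb⟩
      omega
    · rw [Finset.erase_eq_of_notMem ha, Finset.erase_eq_of_notMem hb] at herase
      exact herase
  refine ⟨e, d, hd, ?_, fun a ha => ?_⟩
  · rw [hzero] at hdiff
    omega
  · by_cases ha0 : a = 0
    · subst ha0
      exact Prod.ext hzero (Prod.ext (hdh 0 ha) (hdlast 0 ha).2)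
    · exact hlayer a ha ha0

end

/-! ### Counting layers with roots of unity -/

section

variable {n : ℕ}

-- The numbers `rootExp n t` are `n, …, 3 n - 2` without `2 n - 1`, so they represent each nonzero
-- residue once. The missing factor is that of the root `1`, and the product over all roots is `1 +
-- X ^ (2 n - 1)` because `2 n - 1` is odd.
open Polynomial in
theorem prod_one_add_root_mul (hn : 4 ≤ n) {ξ : ℂ} (hξ : IsPrimitiveRoot ξ (2 * n - 1)) :
    (∏ t ∈ Finset.range (2 * n - 2), (1 + C (ξ ^ rootExp n t) * X)) * (1 + X) =
      (1 + X ^ (2 * n - 1) : ℂ[X]) := by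
  classical
  have hζ : IsPrimitiveRoot (C ξ : ℂ[X]) (2 * n - 1) := hξ.map_of_injective C_injective
  have hodd : Odd (2 * n - 1) := ⟨n - 1, by omega⟩
  have h := hζ.pow_add_pow_eq_prod_add_mul 1 X hodd
  have hinj : Set.InjOn (fun t => (C ξ : ℂ[X]) ^ rootExp n t) (Finset.range (2 * n - 2)) := by
    intro s hs t ht hst
    rw [Finset.coe_range, Set.mem_Iio] at hs ht
    have h1 : (C ξ : ℂ[X]) ^ (rootExp n s - n) = (C ξ : ℂ[X]) ^ (rootExp n t - n) := by
      refine ((hζ.isUnit (by omega)).pow n).mul_left_cancel ?_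
      rw [← pow_add, ← pow_add, Nat.add_sub_cancel' (by unfold rootExp; omega),
        Nat.add_sub_cancel' (by unfold rootExp; omega)]
      exact hst
    have h3 : rootExp n s - n < 2 * n - 1 := by unfold rootExp; split_ifs <;> omega
    have h4 : rootExp n t - n < 2 * n - 1 := by unfold rootExp; split_ifs <;> omega
    have h5 := hζ.pow_inj h3 h4 h1
    unfold rootExp at h5
    split_ifs at h5 <;> omega
  have hone : (1 : ℂ[X]) ∉
      (Finset.range (2 * n - 2)).image fun t => (C ξ : ℂ[X]) ^ rootExp n t := by
    intro h1
    obtain ⟨t, ht, h2⟩ := Finset.mem_image.1 h1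
    rw [Finset.mem_range] at ht
    obtain ⟨c, hc⟩ := (hζ.pow_eq_one_iff_dvd _).1 h2
    have h3 : rootExp n t = n + t ∧ t ≤ n - 2 ∨ rootExp n t = n + t + 1 ∧ n - 2 < t := by
      unfold rootExp; split_ifs <;> omega
    -- The only multiple of `2 n - 1` between `n` and `3 n - 2` is `2 n - 1` itself, which `rootExp`
    -- skips.
    have h4 : c = 1 := by
      have h5 : c ≠ 0 := by rintro rfl; omega
      have h6 : c < 2 := by
        by_contra h7
        have := Nat.mul_le_mul_left (2 * n - 1) (not_lt.1 h7)
        omega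
      omega
    subst h4
    omega
  have hset : nthRootsFinset (2 * n - 1) (1 : ℂ[X]) =
      insert 1 ((Finset.range (2 * n - 2)).image fun t => (C ξ : ℂ[X]) ^ rootExp n t) := by
    symm
    apply Finset.eq_of_subset_of_card_le
    · intro z hz
      rw [mem_nthRootsFinset (by omega)]
      rcases Finset.mem_insert.1 hz with rfl | hz
      · simp
      · obtain ⟨t, -, rfl⟩ := Finset.mem_image.1 hz
        rw [← pow_mul, mul_comm, pow_mul, hζ.pow_eq_one, one_pow]
    · rw [hζ.card_nthRootsFinset, Finset.card_insert_of_notMem hone,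
        Finset.card_image_of_injOn hinj, Finset.card_range]
      omega
  rw [one_pow, hset, Finset.prod_insert hone, Finset.prod_image hinj] at h
  rw [h, one_mul, mul_comm]
  simp only [map_pow]

/-- The elementary symmetric functions of the roots of unity other than `1`. -/
noncomputable def rootEsymm (n : ℕ) (ξ : ℂ) (i : ℕ) : ℂ :=
  ∑ F ∈ (Finset.range (2 * n - 2)).powerset,
    if F.card = i then ∏ t ∈ F, ξ ^ rootExp n t else 0

open Polynomial in
theorem rootEsymm_add (hn : 4 ≤ n) {ξ : ℂ} (hξ : IsPrimitiveRoot ξ (2 * n - 1)) (i : ℕ) :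
    rootEsymm n ξ (i + 1) + rootEsymm n ξ i = if i = 2 * n - 2 then 1 else 0 := by
  have h := prod_one_add_root_mul hn hξ
  have hc : ∀ i, (∏ t ∈ Finset.range (2 * n - 2), (1 + C (ξ ^ rootExp n t) * X)).coeff i =
      rootEsymm n ξ i := by
    intro i
    rw [Finset.prod_one_add, finsetSum_coeff, rootEsymm]
    refine Finset.sum_congr rfl fun F _ => ?_
    rw [Finset.prod_mul_distrib, Finset.prod_const, ← map_prod, coeff_C_mul, coeff_X_pow]
    simp only [eq_comm (a := i), mul_ite, mul_one, mul_zero]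
  have h1 := congrArg (fun p => coeff p (i + 1)) h
  simp only [mul_add, mul_one, coeff_add, coeff_mul_X, hc, coeff_one, coeff_X_pow] at h1
  rw [h1, if_neg (Nat.succ_ne_zero i), zero_add]
  exact if_congr (by omega) rfl rfl

theorem rootEsymm_zero (n : ℕ) (ξ : ℂ) : rootEsymm n ξ 0 = 1 := by
  rw [rootEsymm, Finset.sum_eq_single ∅]
  · simp
  · intro F _ hF
    rw [if_neg (by simpa using hF)]
  · intro h
    exact absurd (Finset.empty_mem_powerset _) h

/-- The left side is the coefficient of `x ^ N` in the generating polynomial of `rootEsymm` times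
`(1 + x) / (1 - x) = 1 + 2 x + 2 x² + …`. -/
theorem rootEsymm_sum (hn : 4 ≤ n) {ξ : ℂ} (hξ : IsPrimitiveRoot ξ (2 * n - 1)) (N : ℕ) :
    rootEsymm n ξ N + 2 * ∑ i ∈ Finset.range N, rootEsymm n ξ i =
      if N ≤ 2 * n - 2 then 1 else 2 := by
  induction N with
  | zero => simp [rootEsymm_zero]
  | succ N ih =>
    have h := rootEsymm_add hn hξ N
    have h1 : rootEsymm n ξ (N + 1) + 2 * ∑ i ∈ Finset.range (N + 1), rootEsymm n ξ i =
        (if N ≤ 2 * n - 2 then 1 else 2) + if N = 2 * n - 2 then 1 else 0 := by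
      rw [Finset.sum_range_succ]
      linear_combination h + ih
    rw [h1]
    rcases lt_trichotomy N (2 * n - 2) with h2 | h2 | h2
    · rw [if_pos h2.le, if_neg h2.ne, if_pos (show N + 1 ≤ 2 * n - 2 from h2), add_zero]
    · rw [if_pos h2.le, if_pos h2, if_neg (by omega)]
      norm_num
    · rw [if_neg (by omega), if_neg h2.ne', if_neg (by omega), add_zero]

/-- The layers with `N` fermions and `j` bosons. -/
noncomputable def layersOfType (n N j : ℕ) : Finset (Finset ℕ × ℤ × ℕ) :=
  ((Finset.range (2 * n - 2)).powerset ×ˢ (Finset.Icc (-N : ℤ) N ×ˢ {j})).filter fun x =>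
    x.1.card + x.2.1.natAbs = N

theorem mem_layersOfType {N j : ℕ} {x : Finset ℕ × ℤ × ℕ} :
    x ∈ layersOfType n N j ↔
      x.1 ⊆ Finset.range (2 * n - 2) ∧ x.1.card + x.2.1.natAbs = N ∧ x.2.2 = j := by
  simp only [layersOfType, Finset.mem_filter, Finset.mem_product, Finset.mem_powerset,
    Finset.mem_Icc, Finset.mem_singleton]
  constructor
  · rintro ⟨⟨h1, -, h2⟩, h3⟩; exact ⟨h1, h3, h2⟩
  · rintro ⟨h1, h3, h2⟩; exact ⟨⟨h1, by omega, h2⟩, h3⟩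

/-- For given `F` there are two, one or no integers `D` with `|D| = N - |F|`, according to `|F| <
N`, `|F| = N` or `|F| > N`; this gives the sum in `rootEsymm_sum`. -/
theorem sum_layersOfType (hn : 4 ≤ n) {ξ : ℂ} (hξ : IsPrimitiveRoot ξ (2 * n - 1)) (N j : ℕ) :
    ∑ x ∈ layersOfType n N j, ∏ t ∈ x.1, ξ ^ rootExp n t = if N ≤ 2 * n - 2 then 1 else 2 := by
  rw [← rootEsymm_sum hn hξ, layersOfType, Finset.sum_filter, Finset.sum_product]
  simp only [rootEsymm]
  rw [Finset.sum_comm (s := Finset.range N), Finset.mul_sum, ← Finset.sum_add_distrib]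
  refine Finset.sum_congr rfl fun F _ => ?_
  rw [Finset.sum_product]
  simp only [Finset.sum_singleton]
  rw [Finset.sum_ite_eq]
  rcases lt_trichotomy F.card N with h | h | h
  · rw [if_neg h.ne, if_pos (Finset.mem_range.2 h), zero_add, ← Finset.sum_filter,
      Finset.sum_const]
    have h1 : (Finset.Icc (-N : ℤ) N).filter (fun D => F.card + D.natAbs = N) =
        {((N - F.card : ℕ) : ℤ), -((N - F.card : ℕ) : ℤ)} := by
      ext D
      simp only [Finset.mem_filter, Finset.mem_Icc, Finset.mem_insert, Finset.mem_singleton]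
      omega
    rw [h1, Finset.card_pair (by omega), nsmul_eq_mul, Nat.cast_ofNat]
  · rw [if_pos h, if_neg (by simp [h]), mul_zero, add_zero, ← Finset.sum_filter, Finset.sum_const]
    have h1 : (Finset.Icc (-N : ℤ) N).filter (fun D => F.card + D.natAbs = N) = {0} := by
      ext D
      simp only [Finset.mem_filter, Finset.mem_Icc, Finset.mem_singleton]
      omega
    rw [h1, Finset.card_singleton, one_smul]
  · rw [if_neg h.ne', if_neg (by simp [h.le]), mul_zero, add_zero]
    refine Finset.sum_eq_zero fun D _ => if_neg (by omega)

theorem eq_Ico_of_isUpper {m : ℕ} {F : Finset ℕ} (hF : F ⊆ Finset.range m)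
    (h : ∀ t ∈ F, t + 1 < m → t + 1 ∈ F) {t : ℕ} (ht : t ∈ F) (ht' : ∀ s ∈ F, t ≤ s) :
    F = Finset.Ico t m := by
  have hup : ∀ k, t + k < m → t + k ∈ F := by
    intro k
    induction k with
    | zero => intro _; exact ht
    | succ k ih => intro hk; exact h _ (ih (by omega)) hk
  ext s
  rw [Finset.mem_Ico]
  constructor
  · intro hs
    exact ⟨ht' s hs, Finset.mem_range.1 (hF hs)⟩
  · rintro ⟨h1, h2⟩
    have := hup (s - t) (by omega)
    rwa [show t + (s - t) = s by omega] at this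

theorem eq_Ico_card {m : ℕ} {F : Finset ℕ} (hF : F ⊆ Finset.range m)
    (h : ∀ t ∈ F, t + 1 < m → t + 1 ∈ F) : F = Finset.Ico (m - F.card) m := by
  rcases F.eq_empty_or_nonempty with rfl | hne
  · simp
  · have h1 := eq_Ico_of_isUpper hF h (F.min'_mem hne) (fun s hs => F.min'_le s hs)
    have h2 := Finset.mem_range.1 (hF (F.min'_mem hne))
    have h3 := congrArg Finset.card h1
    rw [Nat.card_Ico] at h3
    rw [h3, show m - (m - F.min' hne) = F.min' hne by omega]
    exact h1

-- For `D ≠ 0` the set `F` contains `n - 1` but not `n - 2`, and being closed under successors it is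
-- `{n - 1, …, 2 n - 3}`; then `|D| = N - (n - 1)` exceeds `n - 1` exactly if `N > 2 n - 2`. The
-- threshold in the definition of distinguished walls is what makes the count agree with
-- `sum_layersOfType`.
open Classical in
theorem card_allowed (hn : 4 ≤ n) (N j : ℕ) :
    ((layersOfType n N j).filter (IsAllowed n)).card = if N ≤ 2 * n - 2 then 1 else 2 := by
  have hD : ∀ x ∈ layersOfType n N j, IsAllowed n x → x.2.1 ≠ 0 →
      x.1 = Finset.Ico (n - 1) (2 * n - 2) ∧ 2 * n - 2 < N ∧ x.2.1.natAbs = N - (n - 1) := by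
    rintro ⟨F, D, i⟩ hx ⟨h1, h2, h3⟩ h0
    rw [mem_layersOfType] at hx
    simp only at *
    have h4 : n - 2 ∉ F := fun h => h0 (h2 h)
    have h5 : ∀ k, k ≤ n - 2 → n - 2 - k ∉ F := by
      intro k
      induction k with
      | zero => intro _; exact h4
      | succ k ih =>
        intro hk h
        have := h1 _ h (by omega)
        rw [show n - 2 - (k + 1) + 1 = n - 2 - k by omega] at this
        exact ih (by omega) this
    have h6 : F = Finset.Ico (n - 1) (2 * n - 2) := by
      refine eq_Ico_of_isUpper hx.1 h1 (h3 h0).1 fun s hs => ?_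
      by_contra hlt
      have := h5 (n - 2 - s) (by omega)
      rw [show n - 2 - (n - 2 - s) = s by omega] at this
      exact this hs
    have h7 : F.card = n - 1 := by rw [h6, Nat.card_Ico]; omega
    exact ⟨h6, by omega, by omega⟩
  have hD0 : ∀ x ∈ layersOfType n N j, IsAllowed n x → x.2.1 = 0 →
      x.1 = Finset.Ico (2 * n - 2 - N) (2 * n - 2) ∧ N ≤ 2 * n - 2 := by
    rintro ⟨F, D, i⟩ hx ⟨h1, h2, h3⟩ h0
    rw [mem_layersOfType] at hx
    simp only at *
    have h4 : F.card = N := by omega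
    have h5 := Finset.card_le_card hx.1
    rw [Finset.card_range] at h5
    rw [← h4]
    exact ⟨eq_Ico_card hx.1 h1, h5⟩
  have hsub : ∀ a, Finset.Ico a (2 * n - 2) ⊆ Finset.range (2 * n - 2) := fun a t ht => by
    rw [Finset.mem_Ico] at ht
    exact Finset.mem_range.2 ht.2
  have hup : ∀ a t, t ∈ Finset.Ico a (2 * n - 2) → t + 1 < 2 * n - 2 →
      t + 1 ∈ Finset.Ico a (2 * n - 2) := by
    intro a t ht h
    rw [Finset.mem_Ico] at ht ⊢
    omega
  split_ifs with hN
  · rw [Finset.card_eq_one]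
    refine ⟨(Finset.Ico (2 * n - 2 - N) (2 * n - 2), 0, j), ?_⟩
    ext ⟨F, D, i⟩
    rw [Finset.mem_filter, Finset.mem_singleton]
    constructor
    · rintro ⟨hx, hal⟩
      by_cases h0 : D = 0
      · obtain ⟨h1, -⟩ := hD0 _ hx hal h0
        have h2 := (mem_layersOfType.1 hx).2.2
        simp only at h1 h2
        rw [h1, h2, h0]
      · have := (hD _ hx hal h0).2.1
        omega
    · rintro ⟨⟩
      refine ⟨mem_layersOfType.2 ⟨hsub _, ?_, rfl⟩, hup _, fun _ => rfl, fun h => absurd rfl h⟩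
      simp only [Nat.card_Ico, Int.natAbs_zero]
      omega
  · rw [Finset.card_eq_two]
    refine ⟨(Finset.Ico (n - 1) (2 * n - 2), ((N - (n - 1) : ℕ) : ℤ), j),
      (Finset.Ico (n - 1) (2 * n - 2), -((N - (n - 1) : ℕ) : ℤ), j), ?_, ?_⟩
    · intro h
      have h1 := congrArg (fun x => x.2.1) h
      simp only at h1
      omega
    · ext ⟨F, D, i⟩
      rw [Finset.mem_filter, Finset.mem_insert, Finset.mem_singleton]
      constructor
      · rintro ⟨hx, hal⟩
        by_cases h0 : D = 0
        · exact absurd (hD0 _ hx hal h0).2 hN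
        · obtain ⟨h1, -, h2⟩ := hD _ hx hal h0
          have h3 := (mem_layersOfType.1 hx).2.2
          simp only at h1 h2 h3
          rw [h1, h3]
          rcases Int.natAbs_eq D with h4 | h4
          · left; rw [h4, h2]
          · right; rw [h4, h2]
      · have key : ∀ D : ℤ, D.natAbs = N - (n - 1) →
            (Finset.Ico (n - 1) (2 * n - 2), D, j) ∈ layersOfType n N j ∧
            IsAllowed n (Finset.Ico (n - 1) (2 * n - 2), D, j) := by
          intro D hD
          refine ⟨mem_layersOfType.2 ⟨hsub _, ?_, rfl⟩, hup _, fun h => ?_, fun _ => ⟨?_, ?_⟩⟩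
          · simp only [Nat.card_Ico]; omega
          · simp only [Finset.mem_Ico] at h; omega
          · simp only [Finset.mem_Ico]; omega
          · simp only; omega
        rintro (h | h)
        · rw [h]
          exact key _ (Int.natAbs_natCast _)
        · rw [h]
          exact key _ (by rw [Int.natAbs_neg, Int.natAbs_natCast])

/-- The sequences of layers of total weight `2 * k`. -/
noncomputable def layerSeqs (n k : ℕ) : Finset (Fin (k + 1) → Finset ℕ × ℤ × ℕ) :=
  ((Fintype.piFinset fun _ : Fin (k + 1) =>
      Finset.range (2 * k + 1) ×ˢ Finset.range (2 * k + 1)).filter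
    fun T => ∑ a : Fin (k + 1), ((2 * (a : ℕ) + 1) * (T a).1 + 4 * ((a : ℕ) + 1) * (T a).2) =
      2 * k).biUnion
    fun T => Fintype.piFinset fun a => layersOfType n (T a).1 (T a).2

/-- The box bounding the types in `layerSeqs` only serves finiteness: as all coefficients in the
weight are positive, no type of total weight `2 k` leaves it. -/
theorem mem_layerSeqs {k : ℕ} {g : Fin (k + 1) → Finset ℕ × ℤ × ℕ} :
    g ∈ layerSeqs n k ↔ (∀ a, (g a).1 ⊆ Finset.range (2 * n - 2)) ∧
      ∑ a : Fin (k + 1), layerWeight a (g a) = 2 * k := by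
  simp only [layerSeqs, Finset.mem_biUnion, Finset.mem_filter, Fintype.mem_piFinset,
    mem_layersOfType, Finset.mem_product, Finset.mem_range]
  constructor
  · rintro ⟨T, ⟨-, hT⟩, h⟩
    refine ⟨fun a => (h a).1, ?_⟩
    rw [← hT]
    refine Finset.sum_congr rfl fun a _ => ?_
    rw [layerWeight, (h a).2.1, (h a).2.2]
  · rintro ⟨h1, h2⟩
    refine ⟨fun a => ((g a).1.card + (g a).2.1.natAbs, (g a).2.2), ⟨fun a => ?_, h2⟩,
      fun a => ⟨h1 a, rfl, rfl⟩⟩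
    have h3 : layerWeight a (g a) ≤ 2 * k := by
      rw [← h2]
      exact Finset.single_le_sum (f := fun a : Fin (k + 1) => layerWeight a (g a))
        (fun _ _ => Nat.zero_le _) (Finset.mem_univ a)
    unfold layerWeight at h3
    constructor
    · simp only
      nlinarith [Nat.zero_le (2 * (a : ℕ) * ((g a).1.card + (g a).2.1.natAbs)),
        Nat.zero_le (4 * ((a : ℕ) + 1) * (g a).2.2)]
    · simp only
      nlinarith [Nat.zero_le ((2 * (a : ℕ) + 1) * ((g a).1.card + (g a).2.1.natAbs)),
        Nat.zero_le (4 * (a : ℕ) * (g a).2.2)]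

open Classical in
/-- Counting sequences of layers with roots of unity is the same as counting those sequences that
consist of allowed layers. -/
theorem sum_layerSeqs (hn : 4 ≤ n) {ξ : ℂ} (hξ : IsPrimitiveRoot ξ (2 * n - 1)) (k : ℕ) :
    ∑ g ∈ layerSeqs n k, ∏ a, ∏ t ∈ (g a).1, ξ ^ rootExp n t =
      ((layerSeqs n k).filter fun g => ∀ a, IsAllowed n (g a)).card := by
  have hdis : ∀ s : Set (Fin (k + 1) → ℕ × ℕ), s.PairwiseDisjoint
      fun T => Fintype.piFinset fun a => layersOfType n (T a).1 (T a).2 := by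
    intro s T _ T' _ hne
    refine Finset.disjoint_left.2 fun g h1 h2 => hne ?_
    funext a
    have h3 := mem_layersOfType.1 (Fintype.mem_piFinset.1 h1 a)
    have h4 := mem_layersOfType.1 (Fintype.mem_piFinset.1 h2 a)
    exact Prod.ext (h3.2.1.symm.trans h4.2.1) (h3.2.2.symm.trans h4.2.2)
  have hcard : (((layerSeqs n k).filter fun g => ∀ a, IsAllowed n (g a)).card : ℂ) =
      ∑ g ∈ layerSeqs n k, ∏ a, if IsAllowed n (g a) then (1 : ℂ) else 0 := by
    rw [Finset.card_filter, Nat.cast_sum]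
    refine Finset.sum_congr rfl fun g _ => ?_
    rw [Finset.prod_boole]
    simp
  -- For fixed types of all layers both sums factor into products over the layers, which are
  -- compared factor by factor.
  rw [hcard, layerSeqs, Finset.sum_biUnion (hdis _), Finset.sum_biUnion (hdis _)]
  refine Finset.sum_congr rfl fun T _ => ?_
  rw [← Finset.prod_univ_sum (fun a : Fin (k + 1) => layersOfType n (T a).1 (T a).2)
      (fun _ x => ∏ t ∈ x.1, ξ ^ rootExp n t),
    ← Finset.prod_univ_sum (fun a : Fin (k + 1) => layersOfType n (T a).1 (T a).2)
      (fun _ x => if IsAllowed n x then (1 : ℂ) else 0)]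
  refine Finset.prod_congr rfl fun a _ => ?_
  rw [sum_layersOfType hn hξ, Finset.sum_boole, card_allowed hn]
  split_ifs <;> simp

end

/-! ### From layers back to walls and to the power series -/

section

variable {n : ℕ}

theorem YoungWall.exists_ends (Y : YoungWall n) :
    ∃ x : Finset ℕ × (ℕ →₀ ℤ), HalfSupported n x.2 ∧ Y.1 = wallOf n x.1 x.2 := by
  obtain ⟨e, d, h⟩ := Y.2.exists_eq_wallOf
  exact ⟨(e, d), h⟩

/-- The ends of the columns of a wall. -/
noncomputable def YoungWall.ends (Y : YoungWall n) : Finset ℕ × (ℕ →₀ ℤ) := Y.exists_ends.choose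

theorem YoungWall.halfSupported_ends (Y : YoungWall n) : HalfSupported n Y.ends.2 :=
  Y.exists_ends.choose_spec.1

theorem YoungWall.wallOf_ends (Y : YoungWall n) : wallOf n Y.ends.1 Y.ends.2 = Y.1 :=
  Y.exists_ends.choose_spec.2.symm

/-- The first `k + 1` layers of a wall. -/
noncomputable def YoungWall.layers (k : ℕ) (Y : YoungWall n) : Fin (k + 1) → Finset ℕ × ℤ × ℕ :=
  fun a => layerOf n Y.ends.1 Y.ends.2 a

theorem YoungWall.ends_bound (hn : 4 ≤ n) {k : ℕ} {Y : YoungWall n} (h : wt n Y.1 0 = k) :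
    ∀ y, (k + 1) * (2 * n - 4) ≤ y → y ∉ Y.ends.1 ∧ Y.ends.2 y = 0 := by
  intro y hy
  refine bound_of_wt_zero hn Y.halfSupported_ends ?_
  rwa [Y.wallOf_ends, h]

theorem YoungWall.layers_mem (hn : 4 ≤ n) {k : ℕ} {Y : YoungWall n} (h : wt n Y.1 0 = k) :
    Y.layers k ∈ layerSeqs n k := by
  rw [mem_layerSeqs]
  refine ⟨fun a => layerSet_subset _ _ _ _, ?_⟩
  have h1 := two_mul_wt_zero_eq_sum_layers hn Y.halfSupported_ends (YoungWall.ends_bound hn h)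
  rw [Y.wallOf_ends, h, Finset.sum_range] at h1
  exact h1.symm

theorem YoungWall.layers_injOn (hn : 4 ≤ n) (k : ℕ) :
    Set.InjOn (YoungWall.layers k) {Y : YoungWall n | wt n Y.1 0 = k} := by
  intro Y hY Y' hY' h
  have h1 := eq_of_layerOf_eq hn Y.halfSupported_ends Y'.halfSupported_ends
    (YoungWall.ends_bound hn hY) (YoungWall.ends_bound hn hY')
    (fun a ha => congrFun h (⟨a, ha⟩ : Fin (k + 1)))
  apply Subtype.ext
  rw [← Y.wallOf_ends, ← Y'.wallOf_ends, h1.1, h1.2]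

theorem YoungWall.layers_surjOn (hn : 4 ≤ n) (k : ℕ) :
    Set.SurjOn (YoungWall.layers k) {Y : YoungWall n | wt n Y.1 0 = k} (layerSeqs n k) := by
  intro g hg
  rw [Finset.mem_coe, mem_layerSeqs] at hg
  let g' : ℕ → Finset ℕ × ℤ × ℕ := fun a => if h : a < k + 1 then g ⟨a, h⟩ else (∅, 0, 0)
  have hg' : ∀ a : Fin (k + 1), g' a = g a := fun a => dif_pos a.2
  obtain ⟨e, d, hd, hk, hlay⟩ := exists_of_layers hn (k := k) g' (fun a => by
      by_cases h : a < k + 1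
      · rw [show g' a = g ⟨a, h⟩ from dif_pos h]; exact hg.1 _
      · rw [show g' a = (∅, 0, 0) from dif_neg h]; exact Finset.empty_subset _) (by
      rw [Finset.sum_range, ← hg.2]
      exact Finset.sum_congr rfl fun a _ => by rw [hg'])
  let Y : YoungWall n := ⟨wallOf n e d, isYoungWall_wallOf hd⟩
  refine ⟨Y, hk, ?_⟩
  have h1 := wallOf_injective Y.halfSupported_ends hd Y.wallOf_ends
  funext a
  rw [YoungWall.layers, h1.1, h1.2, hlay a a.2, hg']

theorem finite_wt_zero_eq (hn : 4 ≤ n) (k : ℕ) : {Y : YoungWall n | wt n Y.1 0 = k}.Finite :=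
  Set.Finite.of_injOn (fun _ hY => YoungWall.layers_mem hn hY) (YoungWall.layers_injOn hn k)
    (layerSeqs n k).finite_toSet

/-- The layers with index above `k` have empty `F` and `D = 0`, hence are allowed automatically. -/
theorem YoungWall.isDistinguished_iff (hn : 4 ≤ n) {k : ℕ} {Y : YoungWall n}
    (h : wt n Y.1 0 = k) : IsDistinguished n Y.1 ↔ ∀ a, IsAllowed n (Y.layers k a) := by
  rw [← Y.wallOf_ends, isDistinguished_iff_layers hn Y.halfSupported_ends]
  refine ⟨fun H a => H a, fun H a => ?_⟩
  by_cases ha : a < k + 1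
  · exact H ⟨a, ha⟩
  have hb := YoungWall.ends_bound hn h
  have hle : ∀ c b, k + 1 ≤ c → (k + 1) * (2 * n - 4) ≤ c * (2 * n - 4) + b := fun c b hc =>
    (Nat.mul_le_mul_right _ hc).trans (Nat.le_add_right _ _)
  have hempty : ∀ t, t ∉ layerSet n Y.ends.1 Y.ends.2 a := by
    intro t ht
    rcases Nat.eq_zero_or_pos t with rfl | h0
    · rw [zero_mem_layerSet hn, if_neg (by omega),
        (hb (a * (2 * n - 4)) (hle a 0 (by omega))).2] at ht
      exact lt_irrefl _ ht
    · obtain ⟨b, rfl⟩ : ∃ b, t = b + 1 := ⟨t - 1, by omega⟩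
      by_cases hbl : b < 2 * n - 4
      · rw [succ_mem_layerSet hbl] at ht
        exact (hb _ (hle a b (by omega))).1 ht
      · have := Finset.mem_range.1 (layerSet_subset _ _ _ _ ht)
        rw [show b + 1 = 2 * n - 3 by omega, last_mem_layerSet hn,
          (hb ((a + 1) * (2 * n - 4)) (hle (a + 1) 0 (by omega))).2] at ht
        exact (betaBit_eq_one.1 ht).1 rfl
  have hz : Y.ends.2 (a * (2 * n - 4) + (n - 2)) = 0 := (hb _ (hle a _ (by omega))).2
  exact ⟨fun t ht => absurd ht (hempty t), fun _ => hz, fun h0 => absurd hz h0⟩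

theorem YoungWall.pow_whites (hn : 4 ≤ n) {ξ : ℂ} (hξ : IsPrimitiveRoot ξ (2 * n - 1)) {k : ℕ}
    {Y : YoungWall n} (h : wt n Y.1 0 = k) :
    ξ ^ (whites Y.1 + wt n Y.1 0) = ∏ a, ∏ t ∈ (Y.layers k a).1, ξ ^ rootExp n t := by
  have h1 := whites_add_wt_zero_modEq hn Y.halfSupported_ends (YoungWall.ends_bound hn h)
  rw [Y.wallOf_ends] at h1
  rw [pow_eq_pow_of_modEq h1 hξ.pow_eq_one, Finset.sum_range]
  simp only [Finset.prod_pow_eq_pow_sum]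
  rfl

open Classical in
/-- The coefficientwise form of the substitution formula. -/
theorem sum_pow_whites (hn : 4 ≤ n) {ξ : ℂ} (hξ : IsPrimitiveRoot ξ (2 * n - 1)) (k : ℕ) :
    ∑ Y ∈ (finite_wt_zero_eq hn k).toFinset, ξ ^ (whites Y.1 + wt n Y.1 0) =
      (Nat.card {Y : YoungWall n // IsDistinguished n Y.1 ∧ wt n Y.1 0 = k} : ℂ) := by
  have hmem : ∀ Y : YoungWall n, Y ∈ (finite_wt_zero_eq hn k).toFinset ↔ wt n Y.1 0 = k :=
    fun Y => Set.Finite.mem_toFinset _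
  have hinj : Set.InjOn (YoungWall.layers k)
      ((finite_wt_zero_eq hn k).toFinset : Set (YoungWall n)) := by
    rw [Set.Finite.coe_toFinset]; exact YoungWall.layers_injOn hn k
  have hsurj : Set.SurjOn (YoungWall.layers k)
      ((finite_wt_zero_eq hn k).toFinset : Set (YoungWall n)) (layerSeqs n k) := by
    rw [Set.Finite.coe_toFinset]; exact YoungWall.layers_surjOn hn k
  have h1 : ∑ Y ∈ (finite_wt_zero_eq hn k).toFinset, ξ ^ (whites Y.1 + wt n Y.1 0) =
      ∑ g ∈ layerSeqs n k, ∏ a, ∏ t ∈ (g a).1, ξ ^ rootExp n t :=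
    Finset.sum_nbij (YoungWall.layers k) (fun Y hY => YoungWall.layers_mem hn ((hmem Y).1 hY))
      hinj hsurj fun Y hY => YoungWall.pow_whites hn hξ ((hmem Y).1 hY)
  have h2 : ((finite_wt_zero_eq hn k).toFinset.filter fun Y => IsDistinguished n Y.1).card =
      ((layerSeqs n k).filter fun g => ∀ a, IsAllowed n (g a)).card := by
    rw [Finset.card_filter, Finset.card_filter]
    refine Finset.sum_nbij (YoungWall.layers k)
      (fun Y hY => YoungWall.layers_mem hn ((hmem Y).1 hY)) hinj hsurj fun Y hY => ?_
    exact if_congr (YoungWall.isDistinguished_iff hn ((hmem Y).1 hY)) rfl rfl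
  have h3 : Nat.card {Y : YoungWall n // IsDistinguished n Y.1 ∧ wt n Y.1 0 = k} =
      ((finite_wt_zero_eq hn k).toFinset.filter fun Y => IsDistinguished n Y.1).card := by
    rw [← Nat.card_eq_finsetCard]
    refine Nat.card_congr (Equiv.subtypeEquivRight fun Y => ?_)
    rw [Finset.mem_filter, hmem, and_comm]
  rw [h1, sum_layerSeqs hn hξ, h3, h2]

theorem wtVec_apply (Y : Set Block) (j : Fin (n + 1)) : wtVec n Y j = wt n Y j := rfl

theorem wtVec_zero (Y : Set Block) : wtVec n Y 0 = wt n Y 0 := by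
  rw [wtVec_apply, Fin.val_zero]

-- Each block contributes one factor `ξ`, and each block of label `0` a second one; so the exponent
-- is the total number of blocks plus the `0`-weight.
open PowerSeries in
theorem coeff_substitution (F : ℂ) (ξ : ℂ) (v : Fin (n + 1) →₀ ℕ) (k : ℕ) :
    coeff k (C F * v.prod fun i e => (if i = 0 then C (ξ ^ 2) * X else C ξ) ^ e) =
      if v 0 = k then F * ξ ^ ((∑ i, v i) + v 0) else 0 := by
  rw [Finsupp.prod_fintype _ _ (fun _ => pow_zero _), Fin.prod_univ_succ, Fin.sum_univ_succ]
  simp only [if_true, Fin.succ_ne_zero, if_false]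
  rw [Finset.prod_pow_eq_pow_sum, mul_pow, ← map_pow, ← map_pow,
    show ∀ a b c d : PowerSeries ℂ, a * (b * c * d) = (a * b * d) * c by intros; ring,
    ← map_mul, ← map_mul, coeff_C_mul, coeff_X_pow, ← pow_mul]
  by_cases h : v 0 = k
  · rw [if_pos h.symm, if_pos h, mul_one, mul_assoc, ← pow_add]
    congr 2
    ring
  · rw [if_neg (Ne.symm h), if_neg h, mul_zero]

-- Convergence is coefficientwise, and only multi-weights of the finitely many walls of `0`-weight
-- `k` contribute to the coefficient of `q ^ k`. Grouping these walls by multi-weight turns the sum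
-- into that of `sum_pow_whites`.
open scoped PowerSeries.WithPiTopology in
theorem hasSpecialization_wallSeries (hn : 4 ≤ n) {ξ : ℂ} (hξ : IsPrimitiveRoot ξ (2 * n - 1)) :
    HasSpecialization (wallSeries n)
      (fun i : Fin (n + 1) =>
        if i = 0 then PowerSeries.C (ξ ^ 2) * PowerSeries.X else PowerSeries.C ξ)
      (distinguishedSeries n) := by
  classical
  unfold HasSpecialization
  rw [PowerSeries.WithPiTopology.hasSum_iff_hasSum_coeff]
  intro k
  simp only [coeff_substitution]
  let W : Finset (YoungWall n) := (finite_wt_zero_eq hn k).toFinset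
  have hW : ∀ Y : YoungWall n, Y ∈ W ↔ wt n Y.1 0 = k := fun Y => Set.Finite.mem_toFinset _
  have hcard : ∀ v : Fin (n + 1) →₀ ℕ, v 0 = k →
      MvPowerSeries.coeff v (wallSeries n) = (W.filter fun Y => wtVec n Y.1 = v).card := by
    intro v hv
    change ((Nat.card {Y : YoungWall n // wtVec n Y.1 = v} : ℕ) : ℂ) = _
    rw [← Nat.card_eq_finsetCard]
    congr 1
    refine Nat.card_congr (Equiv.subtypeEquivRight fun Y => ?_)
    rw [Finset.mem_filter, hW]
    refine ⟨fun h => ⟨?_, h⟩, fun h => h.2⟩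
    rw [← hv, ← h, wtVec_zero]
  have hexp : ∀ Y : YoungWall n, ∑ i, wtVec n Y.1 i = whites Y.1 := by
    intro Y
    rw [← sum_wt hn Y.2, Finset.sum_range]
    rfl
  have hsum : PowerSeries.coeff k (distinguishedSeries n) =
      ∑ v ∈ W.image fun Y => wtVec n Y.1,
        if v 0 = k then MvPowerSeries.coeff v (wallSeries n) * ξ ^ ((∑ i, v i) + v 0) else 0 := by
    have hmaps : ∀ Y ∈ W, wtVec n Y.1 ∈ W.image fun Y => wtVec n Y.1 := fun Y hY =>
      Finset.mem_image.2 ⟨Y, hY, rfl⟩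
    rw [distinguishedSeries, PowerSeries.coeff_mk, ← sum_pow_whites hn hξ k]
    refine (Finset.sum_fiberwise_of_maps_to hmaps _).symm.trans ?_
    refine Finset.sum_congr rfl fun v hv => ?_
    obtain ⟨Y, hY, rfl⟩ := Finset.mem_image.1 hv
    have hYk : wtVec n Y.1 0 = k := (wtVec_zero _).trans ((hW Y).1 hY)
    rw [if_pos hYk, hcard _ hYk, ← nsmul_eq_mul]
    refine Finset.sum_eq_card_nsmul fun Y' hY' => ?_
    rw [← (Finset.mem_filter.1 hY').2, hexp, wtVec_zero]
  rw [hsum]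
  refine hasSum_sum_of_ne_finset_zero fun v hv => ?_
  by_cases h : v 0 = k
  · rw [if_pos h, hcard v h, Finset.filter_false_of_mem, Finset.card_empty, Nat.cast_zero, zero_mul]
    exact fun Y hY hYv => hv (Finset.mem_image.2 ⟨Y, hY, hYv⟩)
  · rw [if_neg h]

end

end DWall

theorem theorem9p8 (n : ℕ) (hn : 4 ≤ n) (ξ : ℂ) (hξ : IsPrimitiveRoot ξ (2 * n - 1)) :
    (∀ k : ℕ, {Y : DWall.YoungWall n | DWall.wt n Y.1 0 = k}.Finite) ∧
    DWall.HasSpecialization (DWall.wallSeries n)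
      (fun i : Fin (n + 1) =>
        if i = 0 then PowerSeries.C (ξ ^ 2) * PowerSeries.X else PowerSeries.C ξ)
      (DWall.distinguishedSeries n) :=
  ⟨DWall.finite_wt_zero_eq hn, DWall.hasSpecialization_wallSeries hn hξ⟩
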